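/- Let $N\ge 2$, let $\mathcal H_1,\dots,\mathcal H_N$ be complex separable Hilbert spaces, let $\rho$ be a quantum state (a positive trace class operator of trace one) on the Hilbert space tensor product $\mathcal H_1\otimes\cdots\otimes\mathcal H_N$, and let $S_1,\dots,S_N\ge 1$ be integers. **Source operators.** For integers $L_1,\dots,L_N\ge 1$, an $L_1\times\cdots\times L_N$-setting source operator for $\rho$ is a self-adjoint trace class operator $T$ on $\mathcal H_1^{\otimes L_1}\otimes\cdots\otimes\mathcal H_N^{\otimes L_N}$ such that, for every choice of indices $k_n\in\{1,\dots,L_n\}$ and all bounded operators $X_n$ on $\mathcal H_n$, $\mathrm{tr}[T A]=\mathrm{tr}[\rho\,(X_1\otimes\cdots\otimes X_N)]$, where $A$ is the product operator acting as $X_n$ on the $k_n$-th factor of $\mathcal H_n^{\otimes L_n}$, $n=1,\dots,N$, and as the identity on all other factors. **Norms.** $\|T\|_1=\mathrm{tr}|T|$ is the trace norm. A bounded operator $Z$ on a Hilbert space $\mathcal G_1\otimes\cdots\otimes\mathcal G_m$ is tensor positive if $\langle\psi_1\otimes\cdots\otimes\psi_m, Z\,\psi_1\otimes\cdots\otimes\psi_m\rangle\ge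 0$ for all $\psi_j\in\mathcal G_j$. The covering norm of a self-adjoint trace class operator $W$ on $\mathcal G_1\otimes\cdots\otimes\mathcal G_m$ is $\|W\|_{cov}=\inf \mathrm{tr}[C]$ over all trace class $C$ such that $C$, $C+W$ and $C-W$ are tensor positive. For a source operator, the tensor factors $\mathcal G_j$ are all the individual copies of the spaces $\mathcal H_n$. **Maximal Bell violation.** Let $\Lambda_1,\dots,\Lambda_N$ be standard measurable spaces and let $M_n^{(s)}$, $s=1,\dots,S_n$, $n=1,\dots,N$, be normalized positive operator-valued measures on $\Lambda_n$ acting on $\mathcal H_n$. For this quantum scenario let $\gamma$ be the infimum of the total variations of all normalized bounded real-valued measures $\mu$ on $\Lambda_1^{S_1}\times\cdots\times\Lambda_N^{S_N}$ that return all joint distributions of the scenario as marginals, that is, $\mu\{\lambda:\lambda_n^{(s_n)}\in F_n,\ n=1,\dots,N\}=\mathrm{tr}[\rho\,(M_1^{(s_1)}(F_1)\otimes\cdots\otimes M_N^{(s_N)}(F_N))]$ for all $(s_1,\dots,s_N)$ and all measurable $F_n\subseteq\Lambda_n$. The maximal $S_1\times\cdots\times S_N$-setting Bell violation $\Upsilon^{(\rho)}_{S_1\times\cdots\times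 S_N}$ is the supremum of $\gamma$ over all $\Lambda_1,\dots,\Lambda_N$ and all such collections of operator-valued measures. Suprema and infima are taken in $[0,\infty]$. **Theorem.** With these definitions, $$1\le \Upsilon^{(\rho)}_{S_1\times\cdots\times S_N}\ \le\ \inf_{n,\,T}\|T\|_{cov}\ \le\ \inf_{n,\,T}\|T\|_1,$$ where both infima are over all $n=1,\dots,N$ and all $S_1\times\cdots\times S_{n-1}\times 1\times S_{n+1}\times\cdots\times S_N$-setting source operators $T$ for $\rho$ (one setting at site $n$). -/

import Mathlib

open scoped BigOperators ENNReal InnerProductSpace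

universe u v

namespace QuantumBell

section TensorProduct

open scoped ComplexOrder

set_option linter.unusedSectionVars false

variable {ι : Type*} [Fintype ι]

/-- The algebraic tensor product `⨂ᵢ H i` of a finite family of complex vector spaces, as a type
of its own that will carry the inner product with
`⟪⊗ x i, ⊗ y i⟫ = ∏ ⟪x i, y i⟫`. -/
def AlgTensor (H : ι → Type u) [∀ i, NormedAddCommGroup (H i)]
    [∀ i, InnerProductSpace ℂ (H i)] : Type _ :=
  PiTensorProduct ℂ H

variable (H : ι → Type u) [∀ i, NormedAddCommGroup (H i)] [∀ i, InnerProductSpace ℂ (H i)]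

noncomputable instance : AddCommGroup (AlgTensor H) :=
  inferInstanceAs (AddCommGroup (PiTensorProduct ℂ H))

noncomputable instance : Module ℂ (AlgTensor H) :=
  inferInstanceAs (Module ℂ (PiTensorProduct ℂ H))

variable {H}

/-- The elementary tensor `⊗ x i` in the algebraic tensor product. -/
noncomputable def AlgTensor.tmul (x : ∀ i, H i) : AlgTensor H := PiTensorProduct.tprod ℂ x

/-- The multilinear functional `y ↦ ∏ ⟪x i, y i⟫`. -/
noncomputable def prodInner (x : ∀ i, H i) : MultilinearMap ℂ H ℂ :=
  (MultilinearMap.mkPiAlgebra ℂ ι ℂ).compLinearMap (fun i => innerₛₗ ℂ (x i))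

lemma prodInner_apply (x y : ∀ i, H i) : prodInner x y = ∏ i, ⟪x i, y i⟫_ℂ := by
  simp [prodInner]

/-- The linear functional on the algebraic tensor product with `⊗ y i ↦ ∏ ⟪x i, y i⟫`. -/
noncomputable def innerRight (x : ∀ i, H i) : AlgTensor H →ₗ[ℂ] ℂ :=
  PiTensorProduct.lift (prodInner x)

lemma innerRight_tmul (x y : ∀ i, H i) :
    innerRight x (AlgTensor.tmul y) = ∏ i, ⟪x i, y i⟫_ℂ := by
  rw [← prodInner_apply]
  exact PiTensorProduct.lift.tprod y

lemma AlgTensor.exists_rep (t : AlgTensor H) :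
    ∃ (κ : Type) (_ : Fintype κ) (c : κ → ℂ) (x : κ → ∀ i, H i),
      t = ∑ k, c k • AlgTensor.tmul (x k) := by
  refine PiTensorProduct.induction_on (motive := fun t : PiTensorProduct ℂ H =>
    ∃ (κ : Type) (_ : Fintype κ) (c : κ → ℂ) (x : κ → ∀ i, H i),
      (t : AlgTensor H) = ∑ k, c k • AlgTensor.tmul (x k)) t ?_ ?_
  · intro r f
    exact ⟨Unit, inferInstance, fun _ => r, fun _ => f, by simp; rfl⟩
  · rintro a b ⟨κ, _, c, x, ha⟩ ⟨κ', _, c', x', hb⟩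
    refine ⟨κ ⊕ κ', inferInstance, Sum.elim c c', Sum.elim x x', ?_⟩
    simp only [Fintype.sum_sum_type, Sum.elim_inl, Sum.elim_inr]
    exact congrArg₂ (fun p q : AlgTensor H => p + q) ha hb

/-- For fixed `t`, the multilinear functional `x ↦ conj ⟪⊗ x i, t⟫`. -/
noncomputable def conjInnerRight (t : AlgTensor H) : MultilinearMap ℂ H ℂ where
  toFun x := (starRingEnd ℂ) (innerRight x t)
  map_update_add' := by
    intro _ x i a b
    rw [← map_add]
    congr 1
    obtain ⟨κ, _, c, y, rfl⟩ := t.exists_rep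
    simp only [map_sum, map_smul, innerRight_tmul, ← Finset.sum_add_distrib, ← smul_add]
    refine Finset.sum_congr rfl fun k _ => congrArg _ ?_
    have h : ∀ z : H i, ∏ j, ⟪Function.update x i z j, y k j⟫_ℂ =
        ⟪z, y k i⟫_ℂ * ∏ j ∈ Finset.univ.erase i, ⟪x j, y k j⟫_ℂ := by
      intro z
      rw [← Finset.mul_prod_erase _ _ (Finset.mem_univ i), Function.update_self]
      congr 1
      refine Finset.prod_congr rfl fun j hj => ?_
      rw [Function.update_of_ne (Finset.ne_of_mem_erase hj)]
    rw [h, h, h, inner_add_left, add_mul]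
  map_update_smul' := by
    intro _ x i a b
    obtain ⟨κ, _, c, y, rfl⟩ := t.exists_rep
    have h : ∀ (k : κ) (z : H i), ∏ j, ⟪Function.update x i z j, y k j⟫_ℂ =
        ⟪z, y k i⟫_ℂ * ∏ j ∈ Finset.univ.erase i, ⟪x j, y k j⟫_ℂ := by
      intro k z
      rw [← Finset.mul_prod_erase _ _ (Finset.mem_univ i), Function.update_self]
      congr 1
      refine Finset.prod_congr rfl fun j hj => ?_
      rw [Function.update_of_ne (Finset.ne_of_mem_erase hj)]
    simp only [map_sum, map_smul, innerRight_tmul, h, inner_smul_left, smul_eq_mul, map_mul,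
      Complex.conj_conj, Finset.mul_sum]
    refine Finset.sum_congr rfl fun k _ => ?_
    ring

/-- The inner product on the algebraic tensor product: the sesquilinear extension of
`⟪⊗ x i, ⊗ y i⟫ = ∏ ⟪x i, y i⟫`. -/
noncomputable def tensorInner (s t : AlgTensor H) : ℂ :=
  (starRingEnd ℂ) (PiTensorProduct.lift (conjInnerRight t) s)

lemma tensorInner_tmul_left (x : ∀ i, H i) (t : AlgTensor H) :
    tensorInner (AlgTensor.tmul x) t = innerRight x t := by
  have h : PiTensorProduct.lift (conjInnerRight t) (PiTensorProduct.tprod ℂ x) =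
    conjInnerRight t x := PiTensorProduct.lift.tprod x
  unfold tensorInner AlgTensor.tmul
  rw [h]
  exact Complex.conj_conj _

lemma tensorInner_add_left (s s' t : AlgTensor H) :
    tensorInner (s + s') t = tensorInner s t + tensorInner s' t := by
  unfold tensorInner
  rw [← map_add]
  exact congrArg _ (LinearMap.map_add _ _ _)

lemma tensorInner_smul_left (s t : AlgTensor H) (r : ℂ) :
    tensorInner (r • s) t = (starRingEnd ℂ) r * tensorInner s t := by
  unfold tensorInner
  rw [← map_mul]
  exact congrArg _ (LinearMap.map_smul _ _ _)

lemma tensorInner_sum {κ κ' : Type} [Fintype κ] [Fintype κ'] (c : κ → ℂ) (x : κ → ∀ i, H i)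
    (d : κ' → ℂ) (y : κ' → ∀ i, H i) :
    tensorInner (∑ k, c k • AlgTensor.tmul (x k)) (∑ l, d l • AlgTensor.tmul (y l)) =
      ∑ k, ∑ l, (starRingEnd ℂ) (c k) * d l * ∏ i, ⟪x k i, y l i⟫_ℂ := by
  have h : ∀ (s : Finset κ) (t : AlgTensor H),
      tensorInner (∑ k ∈ s, c k • AlgTensor.tmul (x k)) t =
        ∑ k ∈ s, (starRingEnd ℂ) (c k) * innerRight (x k) t := by
    classical
    intro s t
    induction s using Finset.induction_on with
    | empty =>
      have := tensorInner_smul_left (0 : AlgTensor H) t 0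
      simpa using this
    | insert a s ha ih =>
      rw [Finset.sum_insert ha, Finset.sum_insert ha, tensorInner_add_left, ih,
        tensorInner_smul_left, tensorInner_tmul_left]
  rw [h]
  refine Finset.sum_congr rfl fun k _ => ?_
  rw [map_sum, Finset.mul_sum]
  refine Finset.sum_congr rfl fun l _ => ?_
  rw [map_smul, innerRight_tmul, smul_eq_mul, mul_assoc]

/-- If `0 ≤ B i ≤ A i` as Hermitian forms for all `i`, then the entrywise products satisfy
`0 ≤ ∏ B i ≤ ∏ A i`. -/
lemma posSemidef_prod {κ : Type} [Fintype κ] (A B : ι → Matrix κ κ ℂ)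
    (hB : ∀ i, (B i).PosSemidef) (hAB : ∀ i, (A i - B i).PosSemidef) (s : Finset ι) :
    (Matrix.of fun k l => ∏ i ∈ s, B i k l).PosSemidef ∧
      ((Matrix.of fun k l => ∏ i ∈ s, A i k l) -
        Matrix.of fun k l => ∏ i ∈ s, B i k l).PosSemidef := by
  classical
  induction s using Finset.induction_on with
  | empty =>
    constructor
    · have := Matrix.posSemidef_vecMulVec_self_star (R := ℂ) (fun _ : κ => (1 : ℂ))
      convert this using 1
      ext k l
      simp [Matrix.vecMulVec]
    · simpa using Matrix.PosSemidef.zero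
  | insert a s ha ih =>
    have hA : (A a).PosSemidef := by simpa using (hAB a).add (hB a)
    constructor
    · have e : (Matrix.of fun k l => ∏ i ∈ insert a s, B i k l) =
          (B a).hadamard (Matrix.of fun k l => ∏ i ∈ s, B i k l) := by
        ext k l
        simp [Finset.prod_insert ha]
      rw [e]
      exact (hB a).hadamard ih.1
    · have e : ((Matrix.of fun k l => ∏ i ∈ insert a s, A i k l) -
          Matrix.of fun k l => ∏ i ∈ insert a s, B i k l) =
          (A a - B a).hadamard (Matrix.of fun k l => ∏ i ∈ s, B i k l) +
          (A a).hadamard ((Matrix.of fun k l => ∏ i ∈ s, A i k l) -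
            Matrix.of fun k l => ∏ i ∈ s, B i k l) := by
        ext k l
        simp only [Finset.prod_insert ha, Matrix.sub_apply, Matrix.add_apply, Matrix.of_apply,
          Matrix.hadamard_apply]
        ring
      rw [e]
      exact ((hAB a).hadamard ih.1).add (hA.hadamard ih.2)

lemma sum_nonneg_of_posSemidef {κ : Type} [Fintype κ] {A : Matrix κ κ ℂ} (hA : A.PosSemidef)
    (c : κ → ℂ) : 0 ≤ (∑ k, ∑ l, (starRingEnd ℂ) (c k) * c l * A k l).re := by
  have h := (Complex.le_def.1 (hA.dotProduct_mulVec_nonneg c)).1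
  refine le_of_le_of_eq h (congrArg Complex.re ?_)
  simp only [dotProduct, Matrix.mulVec, Finset.mul_sum, Pi.star_apply, RCLike.star_def]
  refine Finset.sum_congr rfl fun k _ => Finset.sum_congr rfl fun l _ => ?_
  ring

lemma posSemidef_inner {E : Type*} [NormedAddCommGroup E] [InnerProductSpace ℂ E]
    {κ : Type} [Fintype κ] (x : κ → E) :
    (Matrix.of fun k l => ⟪x k, x l⟫_ℂ).PosSemidef :=
  Matrix.posSemidef_gram ℂ x

lemma tensorInner_self_nonneg (t : AlgTensor H) : 0 ≤ (tensorInner t t).re := by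
  obtain ⟨κ, _, c, x, rfl⟩ := t.exists_rep
  rw [tensorInner_sum]
  have h := (posSemidef_prod (fun i => Matrix.of fun k l => ⟪x k i, x l i⟫_ℂ)
    (fun i => Matrix.of fun k l => ⟪x k i, x l i⟫_ℂ) (fun i => posSemidef_inner _)
    (fun i => by simpa using Matrix.PosSemidef.zero) Finset.univ).1
  simpa using sum_nonneg_of_posSemidef h c

lemma tensorInner_conj_symm (s t : AlgTensor H) :
    (starRingEnd ℂ) (tensorInner t s) = tensorInner s t := by
  obtain ⟨κ, _, c, x, rfl⟩ := s.exists_rep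
  obtain ⟨κ', _, d, y, rfl⟩ := t.exists_rep
  rw [tensorInner_sum, tensorInner_sum, Finset.sum_comm]
  simp only [map_sum, map_mul, map_prod, Complex.conj_conj, inner_conj_symm]
  refine Finset.sum_congr rfl fun k _ => Finset.sum_congr rfl fun l _ => ?_
  ring

noncomputable instance : PreInnerProductSpace.Core ℂ (AlgTensor H) where
  inner := tensorInner
  conj_inner_symm := tensorInner_conj_symm
  re_inner_nonneg := tensorInner_self_nonneg
  add_left := tensorInner_add_left
  smul_left := tensorInner_smul_left

noncomputable instance : SeminormedAddCommGroup (AlgTensor H) :=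
  InnerProductSpace.Core.toSeminormedAddCommGroup (𝕜 := ℂ)

noncomputable instance : InnerProductSpace ℂ (AlgTensor H) :=
  InnerProductSpace.ofCore inferInstance

variable (H) in
/-- The Hilbert space tensor product `⨂ᵢ H i`: the (Hausdorff) completion of the algebraic tensor
product for the inner product with `⟪⊗ x i, ⊗ y i⟫ = ∏ ⟪x i, y i⟫`. -/
abbrev HTensor : Type _ := UniformSpace.Completion (AlgTensor H)

/-- The product vector `ψ₁ ⊗ ⋯ ⊗ ψₘ` in the Hilbert space tensor product. -/
noncomputable def HTensor.tmul (x : ∀ i, H i) : HTensor H :=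
  ((AlgTensor.tmul x : AlgTensor H) : UniformSpace.Completion (AlgTensor H))

/-- The algebraic tensor product of bounded operators. -/
noncomputable def algMap (X : ∀ i, H i →L[ℂ] H i) : AlgTensor H →ₗ[ℂ] AlgTensor H :=
  PiTensorProduct.map (fun i => (X i : H i →ₗ[ℂ] H i))

lemma algMap_tmul (X : ∀ i, H i →L[ℂ] H i) (x : ∀ i, H i) :
    algMap X (AlgTensor.tmul x) = AlgTensor.tmul fun i => X i (x i) :=
  PiTensorProduct.map_tprod _ _

lemma posSemidef_bound {E : Type*} [NormedAddCommGroup E] [InnerProductSpace ℂ E]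
    {κ : Type} [Fintype κ] (x : κ → E) (X : E →L[ℂ] E) :
    ((Matrix.of fun k l => (‖X‖ : ℂ) ^ 2 * ⟪x k, x l⟫_ℂ) -
      Matrix.of fun k l => ⟪X (x k), X (x l)⟫_ℂ).PosSemidef := by
  refine Matrix.PosSemidef.of_dotProduct_mulVec_nonneg ?_ fun c => ?_
  · ext k l
    simp
  · have h : star c ⬝ᵥ (((Matrix.of fun k l => (‖X‖ : ℂ) ^ 2 * ⟪x k, x l⟫_ℂ) -
        Matrix.of fun k l => ⟪X (x k), X (x l)⟫_ℂ).mulVec c) =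
        ((‖X‖ ^ 2 * ‖∑ k, c k • x k‖ ^ 2 - ‖X (∑ k, c k • x k)‖ ^ 2 : ℝ) : ℂ) := by
      push_cast
      have e : ∀ z : E, ((‖z‖ : ℂ) ^ 2) = ⟪z, z⟫_ℂ := fun z => by
        rw [inner_self_eq_norm_sq_to_K]; rfl
      rw [e, e]
      simp only [map_sum, map_smul, sum_inner, inner_sum, inner_smul_left, inner_smul_right,
        dotProduct, Matrix.mulVec, Finset.mul_sum, ← Finset.sum_sub_distrib, Matrix.sub_apply,
        Matrix.of_apply, Pi.star_apply, RCLike.star_def]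
      conv_rhs => rw [Finset.sum_comm]
      refine Finset.sum_congr rfl fun k _ => Finset.sum_congr rfl fun l _ => ?_
      ring
    rw [h, Complex.zero_le_real, sub_nonneg, ← mul_pow]
    exact pow_le_pow_left₀ (norm_nonneg _) (X.le_opNorm _) 2

lemma norm_algMap_le (X : ∀ i, H i →L[ℂ] H i) (t : AlgTensor H) :
    ‖algMap X t‖ ≤ (∏ i, ‖X i‖) * ‖t‖ := by
  refine le_of_sq_le_sq ?_ (by positivity)
  rw [mul_pow, ← inner_self_eq_norm_sq (𝕜 := ℂ), ← inner_self_eq_norm_sq (𝕜 := ℂ)]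
  change (tensorInner _ _).re ≤ _ * (tensorInner _ _).re
  obtain ⟨κ, _, c, x, rfl⟩ := t.exists_rep
  simp only [map_sum, map_smul, algMap_tmul]
  rw [tensorInner_sum, tensorInner_sum]
  have h := sum_nonneg_of_posSemidef (posSemidef_prod
    (fun i => Matrix.of fun k l => (‖X i‖ : ℂ) ^ 2 * ⟪x k i, x l i⟫_ℂ)
    (fun i => Matrix.of fun k l => ⟪X i (x k i), X i (x l i)⟫_ℂ) (fun i => posSemidef_inner _)
    (fun i => posSemidef_bound _ _) Finset.univ).2 c
  rw [← sub_nonneg]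
  convert h using 1
  rw [← Complex.re_ofReal_mul, ← Complex.sub_re]
  congr 1
  simp only [Finset.mul_sum, ← Finset.sum_sub_distrib, Matrix.sub_apply,
    Matrix.of_apply, Finset.prod_mul_distrib, Finset.prod_pow]
  refine Finset.sum_congr rfl fun k _ => Finset.sum_congr rfl fun l _ => ?_
  push_cast
  ring

/-- The bounded operator `X₁ ⊗ ⋯ ⊗ Xₘ` on the Hilbert space tensor product. -/
noncomputable def tensorOp (X : ∀ i, H i →L[ℂ] H i) : HTensor H →L[ℂ] HTensor H :=
  ((algMap X).mkContinuous (∏ i, ‖X i‖) (norm_algMap_le X)).completion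

lemma tensorOp_tmul (X : ∀ i, H i →L[ℂ] H i) (x : ∀ i, H i) :
    tensorOp X (HTensor.tmul x) = HTensor.tmul fun i => X i (x i) := by
  unfold tensorOp HTensor.tmul
  rw [← algMap_tmul]
  exact UniformSpace.Completion.map_coe
    ((algMap X).mkContinuous (∏ i, ‖X i‖) (norm_algMap_le X)).uniformContinuous _

lemma inner_tmul (x y : ∀ i, H i) :
    ⟪HTensor.tmul x, HTensor.tmul y⟫_ℂ = ∏ i, ⟪x i, y i⟫_ℂ := by
  unfold HTensor.tmul
  rw [UniformSpace.Completion.inner_coe, ← innerRight_tmul, ← tensorInner_tmul_left]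
  rfl

end TensorProduct

section Trace

variable {K : Type*} [NormedAddCommGroup K] [InnerProductSpace ℂ K] [CompleteSpace K]

variable (K) in
/-- An orthonormal basis of the Hilbert space `K`, used to write down traces. -/
noncomputable def onb : HilbertBasis ↥(exists_hilbertBasis ℂ K).choose ℂ K :=
  (exists_hilbertBasis ℂ K).choose_spec.choose

/-- The trace norm `‖T‖₁ = tr |T|`, `|T| = √(T* T)`, with value `∞` if `T` is not trace class. -/
noncomputable def traceNorm (T : K →L[ℂ] K) : ℝ≥0∞ :=
  ∑' i, ENNReal.ofReal (⟪onb K i, CFC.abs T (onb K i)⟫_ℂ).re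

/-- Trace class operators. -/
def IsTraceClass (T : K →L[ℂ] K) : Prop := traceNorm T < ∞

/-- The trace `tr T = ∑ ⟪eᵢ, T eᵢ⟫` of a trace class operator. -/
noncomputable def trace (T : K →L[ℂ] K) : ℂ := ∑' i, ⟪onb K i, T (onb K i)⟫_ℂ

/-- Quantum states (density operators): positive trace class operators of trace one. -/
structure IsState (ρ : K →L[ℂ] K) : Prop where
  isPositive : ρ.IsPositive
  isTraceClass : IsTraceClass ρ
  trace_eq_one : trace ρ = 1

end Trace

section Covering

variable {ι : Type*} [Fintype ι]
variable {G : ι → Type u} [∀ i, NormedAddCommGroup (G i)] [∀ i, InnerProductSpace ℂ (G i)]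

/-- Tensor positivity: `⟪ψ₁ ⊗ ⋯ ⊗ ψₘ, Z (ψ₁ ⊗ ⋯ ⊗ ψₘ)⟫` is real and nonnegative for all `ψᵢ`. -/
def TensorPositive (Z : HTensor G →L[ℂ] HTensor G) : Prop :=
  ∀ ψ : ∀ i, G i,
    0 ≤ (⟪HTensor.tmul ψ, Z (HTensor.tmul ψ)⟫_ℂ).re ∧
      (⟪HTensor.tmul ψ, Z (HTensor.tmul ψ)⟫_ℂ).im = 0

/-- `C` is a covering of `Z`: `C` and `C ± Z` are tensor positive. -/
structure IsCovering (Z C : HTensor G →L[ℂ] HTensor G) : Prop where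
  tensorPositive : TensorPositive C
  add : TensorPositive (C + Z)
  sub : TensorPositive (C - Z)

/-- The covering norm of a self-adjoint trace class operator `W`: the infimum of `tr C` over all
trace class coverings `C` of `W` (these traces are real and nonnegative). -/
noncomputable def coveringNorm (W : HTensor G →L[ℂ] HTensor G) : ℝ≥0∞ :=
  ⨅ (C : HTensor G →L[ℂ] HTensor G) (_ : IsTraceClass C) (_ : IsCovering W C),
    ENNReal.ofReal (trace C).re

end Covering

section Scenario

/-- Normalized positive operator-valued measures on `Λ` with values in the bounded operators on `H`
(only the values on measurable sets matter; σ-additivity is in the weak operator topology). -/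
structure POVM (Λ : Type*) [MeasurableSpace Λ] (H : Type*) [NormedAddCommGroup H]
    [InnerProductSpace ℂ H] where
  /-- the value on a set -/
  op : Set Λ → (H →L[ℂ] H)
  isPositive : ∀ F, MeasurableSet F → (op F).IsPositive
  op_univ : op Set.univ = ContinuousLinearMap.id ℂ H
  hasSum : ∀ F : ℕ → Set Λ, (∀ i, MeasurableSet (F i)) → Pairwise (Function.onFun Disjoint F) →
    ∀ φ ψ : H, HasSum (fun i => ⟪φ, op (F i) ψ⟫_ℂ) ⟪φ, op (⋃ i, F i) ψ⟫_ℂ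

variable {N : ℕ} {H : Fin N → Type u} [∀ n, NormedAddCommGroup (H n)]
  [∀ n, InnerProductSpace ℂ (H n)]

variable (H) in
/-- The Hilbert space `H₁^{⊗ S₁} ⊗ ⋯ ⊗ H_N^{⊗ S_N}`: its tensor factors are indexed by the pairs
`(n, k)` of a site `n` and a copy `k` of `H n`. -/
abbrev CopyTensor (S : Fin N → ℕ) : Type _ :=
  HTensor (fun p : (Σ n : Fin N, Fin (S n)) => H p.1)

/-- `T` is an `S₁ × ⋯ × S_N`-setting source operator for `ρ`: a self-adjoint trace class operator on
`H₁^{⊗ S₁} ⊗ ⋯ ⊗ H_N^{⊗ S_N}` such that `tr[T A] = tr[ρ (X₁ ⊗ ⋯ ⊗ X_N)]` for all bounded operators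
`X n` on `H n`, where `A` acts as `X n` on one chosen copy `k n` of each `H n` and as the identity
on all other copies. -/
structure IsSourceOperator (ρ : HTensor H →L[ℂ] HTensor H) (S : Fin N → ℕ)
    (T : CopyTensor H S →L[ℂ] CopyTensor H S) : Prop where
  isSelfAdjoint : IsSelfAdjoint T
  isTraceClass : IsTraceClass T
  trace_eq : ∀ (k : ∀ n, Fin (S n)) (X : ∀ n, H n →L[ℂ] H n),
    trace (T ∘L tensorOp (fun p : (Σ n : Fin N, Fin (S n)) =>
      if p.2 = k p.1 then X p.1 else ContinuousLinearMap.id ℂ (H p.1))) =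
    trace (ρ ∘L tensorOp X)

/-- The joint probability `tr[ρ (M₁^{(s₁)}(F₁) ⊗ ⋯ ⊗ M_N^{(s_N)}(F_N))]` of the joint measurement
`(s₁, …, s_N)` in the quantum correlation scenario given by the state `ρ` and the POV measures
`M n s`. -/
noncomputable def jointProb (ρ : HTensor H →L[ℂ] HTensor H) {S : Fin N → ℕ}
    {Λ : Fin N → Type v} [∀ n, MeasurableSpace (Λ n)]
    (M : ∀ n, Fin (S n) → POVM (Λ n) (H n)) (s : ∀ n, Fin (S n)) (F : ∀ n, Set (Λ n)) : ℂ :=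
  trace (ρ ∘L tensorOp (fun n => (M n (s n)).op (F n)))

/-- The product space `Λ₁^{S₁} × ⋯ × Λ_N^{S_N}`, with the product σ-algebra. -/
abbrev OutcomeSpace (S : Fin N → ℕ) (Λ : Fin N → Type v) : Type v :=
  ∀ p : (Σ n : Fin N, Fin (S n)), Λ p.1

/-- The bounded real-valued measure `μ` on `Λ₁^{S₁} × ⋯ × Λ_N^{S_N}` is normalized and returns all
joint probability distributions of the scenario as the corresponding marginals. A distribution on
`Λ₁ × ⋯ × Λ_N` is determined by its values on the measurable rectangles `F₁ × ⋯ × F_N`. -/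
structure Simulates (ρ : HTensor H →L[ℂ] HTensor H) {S : Fin N → ℕ}
    {Λ : Fin N → Type v} [∀ n, MeasurableSpace (Λ n)]
    (M : ∀ n, Fin (S n) → POVM (Λ n) (H n))
    (μ : MeasureTheory.SignedMeasure (OutcomeSpace S Λ)) : Prop where
  normalized : μ Set.univ = 1
  marginal : ∀ (s : ∀ n, Fin (S n)) (F : ∀ n, Set (Λ n)), (∀ n, MeasurableSet (F n)) →
    ((μ {ω | ∀ n, ω ⟨n, s n⟩ ∈ F n} : ℝ) : ℂ) = jointProb ρ M s F

/-- The scenario parameter `γ`: the infimum of the total variations of all normalized bounded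
real-valued measures returning all joint distributions of the scenario. -/
noncomputable def scenarioParam (ρ : HTensor H →L[ℂ] HTensor H) {S : Fin N → ℕ}
    {Λ : Fin N → Type v} [∀ n, MeasurableSpace (Λ n)]
    (M : ∀ n, Fin (S n) → POVM (Λ n) (H n)) : ℝ≥0∞ :=
  ⨅ (μ : MeasureTheory.SignedMeasure (OutcomeSpace S Λ)) (_ : Simulates ρ M μ),
    μ.totalVariation Set.univ

/-- The state parameter `Υ^{(ρ,Λ)}_{S₁ × ⋯ × S_N}` for a given outcome set `Λ = Λ₁ × ⋯ × Λ_N`: the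
supremum of `γ` over all collections of POV measures. -/
noncomputable def bellViolationOn (ρ : HTensor H →L[ℂ] HTensor H) (S : Fin N → ℕ)
    (Λ : Fin N → Type v) [∀ n, MeasurableSpace (Λ n)] : ℝ≥0∞ :=
  ⨆ M : (∀ n, Fin (S n) → POVM (Λ n) (H n)), scenarioParam ρ M

/-- The maximal `S₁ × ⋯ × S_N`-setting Bell violation `Υ^{(ρ)}_{S₁ × ⋯ × S_N}`: the supremum of
`Υ^{(ρ,Λ)}_{S₁ × ⋯ × S_N}` over all families `Λ` of standard measurable spaces (in an arbitrary
fixed universe; every standard measurable space is isomorphic to one in any given universe). -/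
noncomputable def bellViolation (ρ : HTensor H →L[ℂ] HTensor H) (S : Fin N → ℕ) : ℝ≥0∞ :=
  ⨆ (Λ : Fin N → Type v) (_ : ∀ n, MeasurableSpace (Λ n)) (_ : ∀ n, StandardBorelSpace (Λ n)),
    bellViolationOn ρ S Λ

end Scenario

end QuantumBell

/-! Fix a site `n₀`, a source operator `T` with one copy at `n₀`, and a covering `C` of `T`. Put a
POV measure on every copy. On products of effects, `A ↦ tr[(C ± T) A] / 2` is nonnegative: with
square roots of the effects and a product orthonormal basis, the trace becomes a sum of expectations
in product vectors, which is all that tensor positivity controls. It is also σ-additive in each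
outcome set separately (`TensorPositive.isMultimeasure`). If positive measures α and β on the
outcomes of all settings have these values as marginals, then `α - β` has marginals `tr[T A]`, which
are the joint probabilities by the source property, and its total variation is at most `α(Ω) + β(Ω)
= tr C`.

Away from `n₀` each setting is measured on its own copy. At `n₀` all settings share one copy, so
each setting `b` there gives its own multimeasure `Ψ b`. These agree once the outcome at `n₀` is
ignored, hence can be glued by making the outcomes at `n₀` conditionally independent given all the
others (`exists_glued_measure`). Neither conditioning nor the passage from multimeasures to measures
is done directly: outcome spaces are embedded in the Cantor space, the gluing is done for words of
length `n` with explicit finite weights, and compactness of the measures of fixed mass gives a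
limit. Its values on rectangles of cylinder sets are the eventual values of the approximations, and
a π-λ argument in each factor gives all rectangles.

The trace is defined through one chosen basis. Factoring a trace class operator into two
Hilbert–Schmidt operators supplies basis independence, cyclicity and normality.

The lower bound holds because total variation dominates `|μ(Ω)| = 1`. The trace norm bound holds
because `|T|` is a covering: `|T| ± T` is twice the positive or negative part of `T`. -/

namespace QuantumBell

/-! ### Hilbert–Schmidt factorization, cyclicity and normality of the trace -/

section TraceClass

variable {K : Type*} [NormedAddCommGroup K] [InnerProductSpace ℂ K]

lemma tsum_enorm_inner_sq {I : Type*} (f : HilbertBasis I ℂ K) (x : K) :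
    ∑' j, ‖⟪f j, x⟫_ℂ‖ₑ ^ 2 = ‖x‖ₑ ^ 2 := by
  have h : HasSum (fun j => ‖⟪f j, x⟫_ℂ‖ ^ 2) (‖x‖ ^ 2) := by
    have := (Complex.reCLM.hasSum (f.hasSum_inner_mul_inner x x))
    convert this using 1
    · funext j
      rw [← inner_conj_symm x (f j)]
      simp only [Complex.reCLM_apply, Complex.conj_mul']
      norm_cast
    · exact (inner_self_eq_norm_sq (𝕜 := ℂ) x).symm
  have e : ∀ y : ℂ, ‖y‖ₑ ^ 2 = ENNReal.ofReal (‖y‖ ^ 2) := fun y => by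
    rw [ENNReal.ofReal_pow (norm_nonneg _), ofReal_norm]
  have e' : ‖x‖ₑ ^ 2 = ENNReal.ofReal (‖x‖ ^ 2) := by
    rw [ENNReal.ofReal_pow (norm_nonneg _), ofReal_norm]
  rw [e', ← h.tsum_eq, ENNReal.ofReal_tsum_of_nonneg (fun _ => by positivity) h.summable]
  simp_rw [e]

variable [CompleteSpace K]

open ContinuousLinearMap (adjoint)

/-- By Parseval both sides are the double sum of `|⟪f j, T (e i)⟫|²`, and in `ℝ≥0∞` the order of
summation is free. Applied twice, this makes the Hilbert–Schmidt condition independent of the basis.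
-/
lemma tsum_enorm_sq_eq_adjoint {I J : Type*} (e : HilbertBasis I ℂ K) (f : HilbertBasis J ℂ K)
    (T : K →L[ℂ] K) : ∑' i, ‖T (e i)‖ₑ ^ 2 = ∑' j, ‖adjoint T (f j)‖ₑ ^ 2 := by
  simp_rw [← tsum_enorm_inner_sq f (T _), ← tsum_enorm_inner_sq e (adjoint T _)]
  rw [ENNReal.tsum_comm]
  refine tsum_congr fun j => tsum_congr fun i => ?_
  rw [ContinuousLinearMap.adjoint_inner_right, ← inner_conj_symm (T (e i)) (f j), RCLike.enorm_conj]

/-- Hilbert–Schmidt operators. -/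
def IsHilbertSchmidt (T : K →L[ℂ] K) : Prop := ∑' i, ‖T (onb K i)‖ₑ ^ 2 < ∞

lemma IsHilbertSchmidt.tsum_lt_top {T : K →L[ℂ] K} (hT : IsHilbertSchmidt T) {I : Type*}
    (e : HilbertBasis I ℂ K) : ∑' i, ‖T (e i)‖ₑ ^ 2 < ∞ := by
  rw [tsum_enorm_sq_eq_adjoint e (onb K), ← tsum_enorm_sq_eq_adjoint (onb K)]
  exact hT

lemma IsHilbertSchmidt.adjoint {T : K →L[ℂ] K} (hT : IsHilbertSchmidt T) :
    IsHilbertSchmidt (adjoint T) := by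
  unfold IsHilbertSchmidt
  rw [← tsum_enorm_sq_eq_adjoint (onb K)]
  exact hT

lemma IsHilbertSchmidt.comp_left {T : K →L[ℂ] K} (hT : IsHilbertSchmidt T) (X : K →L[ℂ] K) :
    IsHilbertSchmidt (X ∘L T) := by
  refine lt_of_le_of_lt (b := ∑' i, ‖X‖ₑ ^ 2 * ‖T (onb K i)‖ₑ ^ 2) ?_ ?_
  · refine ENNReal.tsum_le_tsum fun i => ?_
    rw [← mul_pow]
    gcongr
    exact X.le_opENorm _
  · rw [ENNReal.tsum_mul_left]
    exact ENNReal.mul_lt_top (by simp) hT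

lemma IsHilbertSchmidt.comp_right {T : K →L[ℂ] K} (hT : IsHilbertSchmidt T) (X : K →L[ℂ] K) :
    IsHilbertSchmidt (T ∘L X) := by
  have := (hT.adjoint.comp_left (ContinuousLinearMap.adjoint X)).adjoint
  rwa [ContinuousLinearMap.adjoint_comp, ContinuousLinearMap.adjoint_adjoint,
    ContinuousLinearMap.adjoint_adjoint] at this

lemma summable_sq_norm_of_tsum {I : Type*} {E : Type*} [NormedAddCommGroup E] {x : I → E}
    (h : ∑' i, ‖x i‖ₑ ^ 2 < ∞) : Summable fun i => ‖x i‖ ^ 2 := by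
  have := ENNReal.summable_toReal h.ne
  simpa using this

lemma IsHilbertSchmidt.summable_sq_inner {T : K →L[ℂ] K} (hT : IsHilbertSchmidt T) {I J : Type*}
    (e : HilbertBasis I ℂ K) (f : HilbertBasis J ℂ K) :
    Summable fun p : I × J => ‖⟪f p.2, T (e p.1)⟫_ℂ‖ ^ 2 := by
  refine summable_sq_norm_of_tsum ?_
  rw [ENNReal.tsum_prod (f := fun i j => ‖⟪f j, T (e i)⟫_ℂ‖ₑ ^ 2)]
  simp_rw [tsum_enorm_inner_sq]
  exact hT.tsum_lt_top e

lemma IsHilbertSchmidt.summable_inner {A B : K →L[ℂ] K} (hA : IsHilbertSchmidt A)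
    (hB : IsHilbertSchmidt B) {I J : Type*} (e : HilbertBasis I ℂ K) (f : HilbertBasis J ℂ K) :
    Summable fun p : I × J => ⟪e p.1, A (f p.2)⟫_ℂ * ⟪f p.2, B (e p.1)⟫_ℂ := by
  refine Summable.of_norm_bounded
    (g := fun p : I × J => ‖⟪e p.1, A (f p.2)⟫_ℂ‖ ^ 2 + ‖⟪f p.2, B (e p.1)⟫_ℂ‖ ^ 2)
    (((Equiv.prodComm I J).summable_iff.2 (hA.summable_sq_inner f e)).add
      (hB.summable_sq_inner e f)) fun p => ?_
  rw [norm_mul]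
  nlinarith [two_mul_le_add_sq ‖⟪e p.1, A (f p.2)⟫_ℂ‖ ‖⟪f p.2, B (e p.1)⟫_ℂ‖,
    norm_nonneg ⟪e p.1, A (f p.2)⟫_ℂ, norm_nonneg ⟪f p.2, B (e p.1)⟫_ℂ]

/-- Expanding the middle inner product in the other basis turns both series into one absolutely
convergent double series, summed in two orders. This yields cyclicity and basis independence
together. -/
lemma IsHilbertSchmidt.exists_hasSum_trace {A B : K →L[ℂ] K} (hA : IsHilbertSchmidt A)
    (hB : IsHilbertSchmidt B) {I J : Type*} (e : HilbertBasis I ℂ K) (f : HilbertBasis J ℂ K) :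
    ∃ t : ℂ, HasSum (fun i => ⟪e i, A (B (e i))⟫_ℂ) t ∧ HasSum (fun j => ⟪f j, B (A (f j))⟫_ℂ) t := by
  obtain ⟨t, ht⟩ := hA.summable_inner hB e f
  refine ⟨t, ht.prod_fiberwise fun i => ?_,
    ((Equiv.prodComm J I).hasSum_iff.2 ht).prod_fiberwise fun j => ?_⟩
  · have := f.hasSum_inner_mul_inner (ContinuousLinearMap.adjoint A (e i)) (B (e i))
    simpa only [ContinuousLinearMap.adjoint_inner_left] using this
  · have := e.hasSum_inner_mul_inner (ContinuousLinearMap.adjoint B (f j)) (A (f j))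
    simp only [ContinuousLinearMap.adjoint_inner_left] at this
    simpa only [Function.comp_apply, Equiv.prodComm_apply, Prod.fst_swap, Prod.snd_swap, mul_comm]
      using this

/-- If `‖D x‖ ≤ ‖P x‖` for all `x`, then `D` factors through `P`. -/
lemma exists_comp_of_norm_le (D P : K →L[ℂ] K) (h : ∀ x, ‖D x‖ ≤ ‖P x‖) :
    ∃ U : K →L[ℂ] K, D = U ∘L P := by
  let R : Submodule ℂ K := (LinearMap.range (P : K →ₗ[ℂ] K)).topologicalClosure
  let P' : K →ₗ[ℂ] R := LinearMap.codRestrict R P fun x =>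
    Submodule.le_topologicalClosure _ ⟨x, rfl⟩
  have hd : DenseRange P' := by
    intro y
    rw [Metric.mem_closure_iff]
    intro ε hε
    have hy : (y : K) ∈ closure (LinearMap.range (P : K →ₗ[ℂ] K) : Set K) := y.2
    obtain ⟨_, ⟨x, rfl⟩, hx⟩ := Metric.mem_closure_iff.1 hy ε hε
    exact ⟨_, ⟨x, rfl⟩, hx⟩
  have : CompleteSpace R := (Submodule.isClosed_topologicalClosure _).completeSpace_coe
  -- `P x ↦ D x` is bounded on the range of `P`; it is extended continuously to the closure, and by
  -- zero on the orthogonal complement.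
  let U' : R →L[ℂ] K := (D : K →ₗ[ℂ] K).extendOfNorm P'
  refine ⟨U' ∘L R.orthogonalProjectionOnto, ?_⟩
  ext x
  have h1 : U' (P' x) = D x := LinearMap.extendOfNorm_eq hd ⟨1, fun x => by
    rw [one_mul]
    exact h x⟩ x
  have h2 : R.orthogonalProjectionOnto (P x) = P' x :=
    Submodule.orthogonalProjectionOnto_mem_subspace_eq_self (P' x)
  simp only [ContinuousLinearMap.comp_apply, h2, h1]

/-- Since `‖D x‖ = ‖|D| x‖`, there is `U` with `D = U |D|`. Writing `|D| = P²`, the trace norm of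
`D` is the squared Hilbert–Schmidt norm of `P`, so `D = (U P) P` is the required factorization. -/
lemma IsTraceClass.exists_eq_comp {D : K →L[ℂ] K} (hD : IsTraceClass D) :
    ∃ A B : K →L[ℂ] K, IsHilbertSchmidt A ∧ IsHilbertSchmidt B ∧ D = A ∘L B := by
  have h0 : (0 : K →L[ℂ] K) ≤ CFC.abs D := CFC.abs_nonneg D
  have hn : ∀ x, ‖D x‖ ≤ ‖CFC.abs D x‖ := by
    intro x
    refine le_of_sq_le_sq (le_of_eq ?_) (norm_nonneg _)
    have h1 : ContinuousLinearMap.adjoint (CFC.abs D) = CFC.abs D :=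
      (IsSelfAdjoint.of_nonneg h0).star_eq
    have h2 : CFC.abs D (CFC.abs D x) = ContinuousLinearMap.adjoint D (D x) :=
      congrArg (fun T : K →L[ℂ] K => T x) (CFC.abs_mul_abs D)
    rw [← inner_self_eq_norm_sq (𝕜 := ℂ), ← inner_self_eq_norm_sq (𝕜 := ℂ),
      ← ContinuousLinearMap.adjoint_inner_right, ← h2, ← ContinuousLinearMap.adjoint_inner_right (CFC.abs D), h1]
  obtain ⟨U, hU⟩ := exists_comp_of_norm_le D (CFC.abs D) hn
  set P := CFC.sqrt (CFC.abs D) with hP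
  have hPP : P * P = CFC.abs D := CFC.sqrt_mul_sqrt_self _ h0
  have hPa : ContinuousLinearMap.adjoint P = P :=
    (IsSelfAdjoint.of_nonneg (CFC.sqrt_nonneg (CFC.abs D))).star_eq
  have hPH : IsHilbertSchmidt P := by
    refine lt_of_eq_of_lt (tsum_congr fun i => ?_) hD
    have : CFC.abs D (onb K i) = P (P (onb K i)) := by rw [← hPP]; rfl
    rw [this]
    nth_rw 2 [← hPa]
    rw [ContinuousLinearMap.adjoint_inner_right]
    have := inner_self_eq_norm_sq (𝕜 := ℂ) (P (onb K i))
    simp only [RCLike.re_eq_complex_re] at this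
    rw [this, ENNReal.ofReal_pow (norm_nonneg _), ofReal_norm]
  refine ⟨U ∘L P, P, hPH.comp_left U, hPH, ?_⟩
  rw [ContinuousLinearMap.comp_assoc, hU]
  exact congrArg _ hPP.symm

/-- The trace of `D R R'` for a trace class operator `D` may be computed, after cyclic permutation,
in any orthonormal basis. -/
lemma IsTraceClass.hasSum_trace {D : K →L[ℂ] K} (hD : IsTraceClass D) (R R' : K →L[ℂ] K)
    {I : Type*} (f : HilbertBasis I ℂ K) :
    HasSum (fun i => ⟪f i, R' (D (R (f i)))⟫_ℂ) (trace (D ∘L (R ∘L R'))) := by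
  obtain ⟨A, B, hA, hB, rfl⟩ := hD.exists_eq_comp
  -- Two cyclic moves, meeting at `B R R' A`: from `A (B R R')`, then on to `(R' A)(B R) = R' D R`.
  obtain ⟨t, h1, h2⟩ := hA.exists_hasSum_trace (hB.comp_right (R ∘L R')) (onb K) f
  obtain ⟨t', h3, h4⟩ := (hB.comp_right R).exists_hasSum_trace (hA.comp_left R') f f
  have e : trace ((A ∘L B) ∘L (R ∘L R')) = t := h1.tsum_eq
  rw [e, h2.unique h3]
  exact h4

/-- Normality of the functional `Y ↦ tr[D Y]`. -/
lemma IsTraceClass.tendsto_trace {D : K →L[ℂ] K} (hD : IsTraceClass D) {α : Type*} {l : Filter α}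
    {Y : α → K →L[ℂ] K} {Z : K →L[ℂ] K} {c : ℝ} (hY : ∀ a, ‖Y a‖ ≤ c)
    (h : ∀ x y, Filter.Tendsto (fun a => ⟪x, Y a y⟫_ℂ) l (nhds ⟪x, Z y⟫_ℂ)) :
    Filter.Tendsto (fun a => trace (D ∘L Y a)) l (nhds (trace (D ∘L Z))) := by
  obtain ⟨A, B, hA, hB, rfl⟩ := hD.exists_eq_comp
  -- In this form the `i`-th term is a single matrix element of `X`, bounded by `‖X‖ ‖B* eᵢ‖ ‖A
  -- eᵢ‖`, which is summable; dominated convergence applies.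
  have e : ∀ X : K →L[ℂ] K, trace ((A ∘L B) ∘L X) =
      ∑' i, ⟪ContinuousLinearMap.adjoint B (onb K i), X (A (onb K i))⟫_ℂ := by
    intro X
    obtain ⟨t, h1, h2⟩ := hA.exists_hasSum_trace (hB.comp_right X) (onb K) (onb K)
    have : trace ((A ∘L B) ∘L X) = t := h1.tsum_eq
    rw [this, ← h2.tsum_eq]
    simp only [ContinuousLinearMap.adjoint_inner_left, ContinuousLinearMap.comp_apply]
  simp_rw [e]
  refine tendsto_tsum_of_dominated_convergence
    (bound := fun i => c * (‖ContinuousLinearMap.adjoint B (onb K i)‖ ^ 2 + ‖A (onb K i)‖ ^ 2))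
    (((summable_sq_norm_of_tsum hB.adjoint).add (summable_sq_norm_of_tsum hA)).mul_left c)
    (fun i => h _ _) (Filter.Eventually.of_forall fun a i => ?_)
  have hc : 0 ≤ c := (norm_nonneg _).trans (hY a)
  refine (norm_inner_le_norm _ _).trans ?_
  calc ‖ContinuousLinearMap.adjoint B (onb K i)‖ * ‖Y a (A (onb K i))‖
      ≤ ‖ContinuousLinearMap.adjoint B (onb K i)‖ * (c * ‖A (onb K i)‖) := by
        gcongr
        exact (Y a).le_of_opNorm_le (hY a) _
    _ = c * (‖ContinuousLinearMap.adjoint B (onb K i)‖ * ‖A (onb K i)‖) := by ring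
    _ ≤ _ := by
        gcongr
        nlinarith [sq_nonneg (‖ContinuousLinearMap.adjoint B (onb K i)‖ - ‖A (onb K i)‖),
          sq_nonneg ‖ContinuousLinearMap.adjoint B (onb K i)‖, sq_nonneg ‖A (onb K i)‖]

omit [CompleteSpace K] in
lemma tendsto_inner_right_of_dense {α : Type*} {l : Filter α}
    {Y : α → K →L[ℂ] K} {Z : K →L[ℂ] K} {c : ℝ} (hY : ∀ a, ‖Y a‖ ≤ c) {s : Set K}
    (hs : Dense (Submodule.span ℂ s : Set K)) (x : K)
    (h : ∀ y ∈ s, Filter.Tendsto (fun a => ⟪x, Y a y⟫_ℂ) l (nhds ⟪x, Z y⟫_ℂ)) (y : K) :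
    Filter.Tendsto (fun a => ⟪x, Y a y⟫_ℂ) l (nhds ⟪x, Z y⟫_ℂ) := by
  rcases isEmpty_or_nonempty α with hα | ⟨⟨a₀⟩⟩
  · rw [Filter.filter_eq_bot_of_isEmpty l]
    exact Filter.tendsto_bot
  have hc : 0 ≤ c := (norm_nonneg _).trans (hY a₀)
  have hspan : ∀ y ∈ Submodule.span ℂ s,
      Filter.Tendsto (fun a => ⟪x, Y a y⟫_ℂ) l (nhds ⟪x, Z y⟫_ℂ) := by
    intro y hy
    induction hy using Submodule.span_induction with
    | mem y hy => exact h y hy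
    | zero => simpa using tendsto_const_nhds
    | add y z _ _ hy hz => simpa only [map_add, inner_add_right] using hy.add hz
    | smul r y _ hy => simpa only [map_smul, inner_smul_right] using hy.const_mul r
  rw [Metric.tendsto_nhds]
  intro ε hε
  set M := ‖x‖ * (c + ‖Z‖) + 1 with hM
  have hM0 : 0 < M := by positivity
  obtain ⟨z, hz, hyz⟩ := Metric.mem_closure_iff.1 (hs y) (ε / 2 / M) (by positivity)
  rw [dist_eq_norm] at hyz
  filter_upwards [Metric.tendsto_nhds.1 (hspan z hz) (ε / 2) (by positivity)] with a ha
  rw [dist_eq_norm, ← inner_sub_right] at ha ⊢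
  have e : Y a y - Z y = (Y a z - Z z) + (Y a (y - z) - Z (y - z)) := by
    simp only [map_sub]
    abel
  rw [e, inner_add_right]
  have h2 : ‖⟪x, Y a (y - z) - Z (y - z)⟫_ℂ‖ ≤ ‖x‖ * (c + ‖Z‖) * ‖y - z‖ := by
    refine (norm_inner_le_norm _ _).trans ?_
    rw [mul_assoc]
    gcongr
    refine (norm_sub_le _ _).trans ?_
    rw [add_mul]
    exact add_le_add ((Y a).le_of_opNorm_le (hY a) _) (Z.le_opNorm _)
  have h3 : ‖x‖ * (c + ‖Z‖) * ‖y - z‖ ≤ M * ‖y - z‖ := by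
    gcongr
    linarith
  have h4 : M * ‖y - z‖ < ε / 2 := by rwa [lt_div_iff₀ hM0, mul_comm] at hyz
  refine (norm_add_le _ _).trans_lt ?_
  linarith

/-- Weak operator convergence of a bounded family may be tested on sets spanning dense subspaces. -/
lemma tendsto_inner_of_dense {α : Type*} {l : Filter α}
    {Y : α → K →L[ℂ] K} {Z : K →L[ℂ] K} {c : ℝ} (hY : ∀ a, ‖Y a‖ ≤ c) {s : Set K}
    (hs : Dense (Submodule.span ℂ s : Set K))
    (h : ∀ x ∈ s, ∀ y ∈ s, Filter.Tendsto (fun a => ⟪x, Y a y⟫_ℂ) l (nhds ⟪x, Z y⟫_ℂ)) (x y : K) :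
    Filter.Tendsto (fun a => ⟪x, Y a y⟫_ℂ) l (nhds ⟪x, Z y⟫_ℂ) := by
  have h1 := fun x hx => tendsto_inner_right_of_dense hY hs x (h x hx)
  -- The second variable has been freed; passing to adjoints frees the first in the same way.
  have h2 := tendsto_inner_right_of_dense (Y := fun a => ContinuousLinearMap.adjoint (Y a))
    (Z := ContinuousLinearMap.adjoint Z) (l := l) (c := c)
    (fun a => by rw [LinearIsometryEquiv.norm_map]; exact hY a) hs y (fun x hx => by
      have := (Complex.continuous_conj.tendsto _).comp (h1 x hx y)
      simpa only [Function.comp_def, inner_conj_symm, ContinuousLinearMap.adjoint_inner_right]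
        using this) x
  have := (Complex.continuous_conj.tendsto _).comp h2
  simpa only [Function.comp_def, inner_conj_symm, ContinuousLinearMap.adjoint_inner_left] using this

end TraceClass

/-! ### Product bases, product operators, and tensor positivity -/

section TensorOperators

open scoped ComplexOrder

variable {ι : Type*} [Fintype ι] {H : ι → Type u} [∀ i, NormedAddCommGroup (H i)]
  [∀ i, InnerProductSpace ℂ (H i)]

lemma dense_span_tmul :
    Dense (Submodule.span ℂ (Set.range (HTensor.tmul (H := H))) : Set (HTensor H)) := by
  refine Dense.mono ?_ (UniformSpace.Completion.denseRange_coe (α := AlgTensor H))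
  rintro _ ⟨t, rfl⟩
  obtain ⟨κ, _, c, x, rfl⟩ := t.exists_rep
  have e : ((∑ k, c k • AlgTensor.tmul (x k) : AlgTensor H) : HTensor H) =
      ∑ k, c k • HTensor.tmul (x k) := by
    have := map_sum (UniformSpace.Completion.toComplL (𝕜 := ℂ) (E := AlgTensor H))
      (fun k => c k • AlgTensor.tmul (x k)) Finset.univ
    simp only [UniformSpace.Completion.coe_toComplL, UniformSpace.Completion.coe_smul] at this
    exact this
  rw [e]
  exact Submodule.sum_mem _ fun k _ => Submodule.smul_mem _ _ (Submodule.subset_span ⟨_, rfl⟩)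

lemma ext_tmul {E : Type*} [NormedAddCommGroup E] [NormedSpace ℂ E] {A B : HTensor H →L[ℂ] E}
    (h : ∀ x, A (HTensor.tmul x) = B (HTensor.tmul x)) : A = B :=
  ContinuousLinearMap.ext_on dense_span_tmul (by rintro _ ⟨x, rfl⟩; exact h x)

lemma eq_of_inner_tmul {u w : HTensor H}
    (h : ∀ x, ⟪HTensor.tmul x, u⟫_ℂ = ⟪HTensor.tmul x, w⟫_ℂ) : u = w := by
  have : innerSL ℂ u = innerSL ℂ w := ext_tmul fun x => by
    simp only [innerSL_apply_apply]
    rw [← inner_conj_symm, h, inner_conj_symm]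
  exact ext_inner_right ℂ fun z => by simpa using congrArg (fun f => f z) this

lemma HTensor.tmul_update_add [DecidableEq ι] (x : ∀ i, H i) (i : ι) (a b : H i) :
    HTensor.tmul (Function.update x i (a + b)) =
      HTensor.tmul (Function.update x i a) + HTensor.tmul (Function.update x i b) := by
  unfold HTensor.tmul
  rw [← UniformSpace.Completion.coe_add]
  exact congrArg _ ((PiTensorProduct.tprod ℂ).map_update_add x i a b)

lemma HTensor.tmul_update_smul [DecidableEq ι] (x : ∀ i, H i) (i : ι) (c : ℂ) (a : H i) :
    HTensor.tmul (Function.update x i (c • a)) = c • HTensor.tmul (Function.update x i a) := by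
  unfold HTensor.tmul
  rw [← UniformSpace.Completion.coe_smul]
  exact congrArg _ ((PiTensorProduct.tprod ℂ).map_update_smul x i c a)

lemma HTensor.norm_tmul (x : ∀ i, H i) : ‖HTensor.tmul x‖ = ∏ i, ‖x i‖ := by
  have h : ((‖HTensor.tmul x‖ ^ 2 : ℝ) : ℂ) = ((∏ i, ‖x i‖) ^ 2 : ℝ) := by
    push_cast
    rw [← Finset.prod_pow]
    have e := inner_tmul x x
    simp only [inner_self_eq_norm_sq_to_K] at e
    exact e
  exact (sq_eq_sq₀ (norm_nonneg _) (by positivity)).1 (Complex.ofReal_injective h)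

/-- The product vector as a continuous linear function of one factor. -/
noncomputable def HTensor.tmulCLM [DecidableEq ι] (x : ∀ i, H i) (i : ι) : H i →L[ℂ] HTensor H :=
  LinearMap.mkContinuous
    { toFun := fun a => HTensor.tmul (Function.update x i a)
      map_add' := HTensor.tmul_update_add x i
      map_smul' := HTensor.tmul_update_smul x i }
    (∏ j ∈ Finset.univ.erase i, ‖x j‖) (fun a => by
      simp only [LinearMap.coe_mk, AddHom.coe_mk]
      rw [HTensor.norm_tmul, ← Finset.mul_prod_erase _ _ (Finset.mem_univ i),
        Function.update_self, mul_comm]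
      refine le_of_eq (congrArg (· * _) (Finset.prod_congr rfl fun j hj => ?_))
      rw [Function.update_of_ne (Finset.ne_of_mem_erase hj)])

lemma HTensor.tmulCLM_apply [DecidableEq ι] (x : ∀ i, H i) (i : ι) (a : H i) :
    HTensor.tmulCLM x i a = HTensor.tmul (Function.update x i a) := rfl

lemma orthonormal_tmul {J : ι → Type*} (e : ∀ i, HilbertBasis (J i) ℂ (H i)) :
    Orthonormal ℂ (fun j : ∀ i, J i => HTensor.tmul fun i => e i (j i)) := by
  classical
  rw [orthonormal_iff_ite]
  intro j k
  rw [inner_tmul]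
  simp_rw [orthonormal_iff_ite.1 (e _).orthonormal]
  split_ifs with h
  · simp [h]
  · obtain ⟨i, hi⟩ := Function.ne_iff.1 h
    exact Finset.prod_eq_zero (Finset.mem_univ i) (if_neg hi)

/-- Basis vectors are replaced by arbitrary vectors one factor at a time: `u` is orthogonal to `⊗
xᵢ` whenever `xᵢ` is a basis vector outside `s`. Enlarging `s` uses linearity and continuity in the
new factor. -/
lemma span_tmul_orthogonal_eq_bot {J : ι → Type*} (e : ∀ i, HilbertBasis (J i) ℂ (H i)) :
    (Submodule.span ℂ (Set.range fun j : ∀ i, J i => HTensor.tmul fun i => e i (j i)))ᗮ = ⊥ := by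
  classical
  rw [Submodule.eq_bot_iff]
  intro u hu
  have key : ∀ s : Finset ι, ∀ x : ∀ i, H i, (∀ i, i ∉ s → ∃ j, x i = e i j) →
      ⟪HTensor.tmul x, u⟫_ℂ = 0 := by
    intro s
    induction s using Finset.induction_on with
    | empty =>
      intro x hx
      choose j hj using fun i => hx i (Finset.notMem_empty i)
      obtain rfl : x = fun i => e i (j i) := funext hj
      exact Submodule.inner_right_of_mem_orthogonal
        (Submodule.subset_span (Set.mem_range_self j)) hu
    | insert i s _ ih =>
      intro x hx
      have h0 : innerSL ℂ u ∘L HTensor.tmulCLM x i = 0 := by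
        refine ContinuousLinearMap.ext_on
          (by
            rw [dense_iff_closure_eq, ← Submodule.topologicalClosure_coe, (e i).dense_span]
            rfl) (s := Set.range (e i)) ?_
        rintro _ ⟨j, rfl⟩
        have := ih (Function.update x i (e i j)) fun k hk => by
          by_cases hki : k = i
          · subst hki
            exact ⟨j, Function.update_self ..⟩
          · rw [Function.update_of_ne hki]
            exact hx k (by simp [hki, hk])
        simp only [ContinuousLinearMap.comp_apply, innerSL_apply_apply, HTensor.tmulCLM_apply,
          zero_apply]
        rw [← inner_conj_symm, this, map_zero]
      have h1 := congrArg (fun f => f (x i)) h0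
      simp only [ContinuousLinearMap.comp_apply, innerSL_apply_apply, HTensor.tmulCLM_apply,
          zero_apply, Function.update_eq_self] at h1
      rw [← inner_conj_symm, h1, map_zero]
  refine eq_of_inner_tmul fun x => ?_
  rw [key Finset.univ x fun i hi => absurd (Finset.mem_univ i) hi, inner_zero_right]

/-- The product of Hilbert bases of the factors. -/
noncomputable def tensorBasis {J : ι → Type*} (e : ∀ i, HilbertBasis (J i) ℂ (H i)) :
    HilbertBasis (∀ i, J i) ℂ (HTensor H) :=
  HilbertBasis.mkOfOrthogonalEqBot (orthonormal_tmul e) (span_tmul_orthogonal_eq_bot e)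

lemma tensorBasis_apply {J : ι → Type*} (e : ∀ i, HilbertBasis (J i) ℂ (H i)) (j : ∀ i, J i) :
    tensorBasis e j = HTensor.tmul fun i => e i (j i) := by
  simp [tensorBasis]

lemma tensorOp_comp (X Y : ∀ i, H i →L[ℂ] H i) :
    tensorOp X ∘L tensorOp Y = tensorOp fun i => X i ∘L Y i :=
  ext_tmul fun x => by simp [tensorOp_tmul]

lemma tensorOp_id : tensorOp (fun i => ContinuousLinearMap.id ℂ (H i)) =
    ContinuousLinearMap.id ℂ (HTensor H) :=
  ext_tmul fun x => by simp [tensorOp_tmul]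

lemma tensorOp_update_add [DecidableEq ι] (X : ∀ i, H i →L[ℂ] H i) (i : ι) (A B : H i →L[ℂ] H i) :
    tensorOp (Function.update X i (A + B)) =
      tensorOp (Function.update X i A) + tensorOp (Function.update X i B) := by
  refine ext_tmul fun x => ?_
  have e : ∀ C : H i →L[ℂ] H i, (fun k => Function.update X i C k (x k)) =
      Function.update (fun k => X k (x k)) i (C (x i)) := by
    intro C
    funext k
    by_cases hk : k = i
    · subst hk
      simp
    · simp [hk]
  simp only [add_apply, tensorOp_tmul, e, HTensor.tmul_update_add]

lemma tensorOp_eq_zero (X : ∀ i, H i →L[ℂ] H i) (i : ι) (hi : X i = 0) : tensorOp X = 0 := by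
  refine ext_tmul fun x => ?_
  rw [tensorOp_tmul, zero_apply, ← norm_eq_zero, HTensor.norm_tmul]
  exact Finset.prod_eq_zero (Finset.mem_univ i) (by simp [hi])

lemma norm_tensorOp_le (X : ∀ i, H i →L[ℂ] H i) : ‖tensorOp X‖ ≤ ∏ i, ‖X i‖ := by
  unfold tensorOp
  refine ContinuousLinearMap.opNorm_le_bound _ (by positivity) fun u => ?_
  induction u using UniformSpace.Completion.induction_on with
  | hp => exact isClosed_le (by fun_prop) (by fun_prop)
  | ih t =>
    have e : ((algMap X).mkContinuous (∏ i, ‖X i‖) (norm_algMap_le X)).completion t =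
        (algMap X t : HTensor H) := UniformSpace.Completion.map_coe
      ((algMap X).mkContinuous (∏ i, ‖X i‖) (norm_algMap_le X)).uniformContinuous _
    rw [e, UniformSpace.Completion.norm_coe, UniformSpace.Completion.norm_coe]
    exact norm_algMap_le X t

variable [∀ i, CompleteSpace (H i)]

lemma adjoint_tensorOp (X : ∀ i, H i →L[ℂ] H i) :
    ContinuousLinearMap.adjoint (tensorOp X) =
      tensorOp fun i => ContinuousLinearMap.adjoint (X i) := by
  refine ext_tmul fun x => eq_of_inner_tmul fun y => ?_
  rw [ContinuousLinearMap.adjoint_inner_right, tensorOp_tmul, tensorOp_tmul, inner_tmul,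
    inner_tmul]
  simp only [ContinuousLinearMap.adjoint_inner_right]

/-- A tensor positive trace class operator is positive on products of positive operators. -/
lemma TensorPositive.trace_nonneg {C T : HTensor H →L[ℂ] HTensor H} (hC : IsTraceClass C)
    (hT : IsTraceClass T) (h : TensorPositive (C + T)) (X : ∀ i, H i →L[ℂ] H i)
    (hX : ∀ i, (X i).IsPositive) :
    0 ≤ trace (C ∘L tensorOp X) + trace (T ∘L tensorOp X) := by
  have hX0 : ∀ i, 0 ≤ X i := fun i => (ContinuousLinearMap.nonneg_iff_isPositive _).2 (hX i)
  set R := fun i => CFC.sqrt (X i) with hR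
  have hRR : ∀ i, R i ∘L R i = X i := fun i => CFC.sqrt_mul_sqrt_self _ (hX0 i)
  have hRa : ∀ i, ContinuousLinearMap.adjoint (R i) = R i :=
    fun i => (IsSelfAdjoint.of_nonneg (CFC.sqrt_nonneg (X i))).star_eq
  have e : tensorOp X = tensorOp R ∘L tensorOp R := by
    rw [tensorOp_comp]
    simp only [hRR]
  have ea : ContinuousLinearMap.adjoint (tensorOp R) = tensorOp R := by
    rw [adjoint_tensorOp]
    simp only [hRa]
  -- The product basis is essential: the square roots `R` map its elements to product vectors, on
  -- which `C + T` has nonnegative expectation. Adding two series avoids having to show that `C + T`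
  -- is trace class.
  have hs := (hC.hasSum_trace (tensorOp R) (tensorOp R) (tensorBasis fun i => onb (H i))).add
    (hT.hasSum_trace (tensorOp R) (tensorOp R) (tensorBasis fun i => onb (H i)))
  rw [e]
  refine hs.nonneg fun j => ?_
  rw [tensorBasis_apply, ← inner_add_right, ← map_add, ← ea,
    ContinuousLinearMap.adjoint_inner_right, ea, tensorOp_tmul]
  exact Complex.le_def.2 ⟨(h _).1, (h _).2.symm⟩

omit [∀ i, CompleteSpace (H i)] in
/-- Weak continuity of `tensorOp` in one factor, on bounded sets. -/
lemma tendsto_inner_tensorOp_update [DecidableEq ι] {α : Type*} {l : Filter α}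
    (X : ∀ i, H i →L[ℂ] H i) (i : ι) {Y : α → H i →L[ℂ] H i} {Z : H i →L[ℂ] H i} {c : ℝ}
    (hY : ∀ a, ‖Y a‖ ≤ c)
    (h : ∀ x y, Filter.Tendsto (fun a => ⟪x, Y a y⟫_ℂ) l (nhds ⟪x, Z y⟫_ℂ)) (x y : HTensor H) :
    Filter.Tendsto (fun a => ⟪x, tensorOp (Function.update X i (Y a)) y⟫_ℂ) l
      (nhds ⟪x, tensorOp (Function.update X i Z) y⟫_ℂ) := by
  have e : ∀ W : H i →L[ℂ] H i, ∏ j, ‖Function.update X i W j‖ =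
      ‖W‖ * ∏ j ∈ Finset.univ.erase i, ‖X j‖ := by
    intro W
    rw [← Finset.mul_prod_erase _ _ (Finset.mem_univ i), Function.update_self]
    congr 1
    refine Finset.prod_congr rfl fun j hj => ?_
    rw [Function.update_of_ne (Finset.ne_of_mem_erase hj)]
  refine tendsto_inner_of_dense (c := c * ∏ j ∈ Finset.univ.erase i, ‖X j‖)
    (fun a => (norm_tensorOp_le _).trans ?_) dense_span_tmul ?_ x y
  · rw [e]
    gcongr
    exact hY a
  · rintro _ ⟨p, rfl⟩ _ ⟨q, rfl⟩
    have e' : ∀ W : H i →L[ℂ] H i,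
        ⟪HTensor.tmul p, tensorOp (Function.update X i W) (HTensor.tmul q)⟫_ℂ =
        ⟪p i, W (q i)⟫_ℂ * ∏ j ∈ Finset.univ.erase i, ⟪p j, X j (q j)⟫_ℂ := by
      intro W
      rw [tensorOp_tmul, inner_tmul, ← Finset.mul_prod_erase _ _ (Finset.mem_univ i),
        Function.update_self]
      congr 1
      refine Finset.prod_congr rfl fun j hj => ?_
      rw [Function.update_of_ne (Finset.ne_of_mem_erase hj)]
    simp_rw [e']
    exact (h _ _).mul_const _

end TensorOperators

/-! ### Finite additivity and norm bounds for POV measures -/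

section POVM

variable {Λ : Type*} [MeasurableSpace Λ] {E : Type*} [NormedAddCommGroup E]
  [InnerProductSpace ℂ E]

/-- σ-additivity on the constant sequence `∅` makes a constant series over `ℕ` summable, so its term
vanishes. -/
lemma POVM.op_empty (M : POVM Λ E) : M.op ∅ = 0 := by
  ext ψ
  refine ext_inner_left ℂ fun φ => ?_
  have h := (M.hasSum (fun _ => ∅) (fun _ => .empty) (fun _ _ _ => by simp [Function.onFun]) φ ψ)
  simp only [Set.iUnion_empty] at h
  rw [(summable_const_iff _).1 h.summable]
  simp

lemma POVM.op_biUnion (M : POVM Λ E) {F : ℕ → Set Λ} (hF : ∀ i, MeasurableSet (F i))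
    (hd : Pairwise (Function.onFun Disjoint F)) (s : Finset ℕ) :
    M.op (⋃ i ∈ s, F i) = ∑ i ∈ s, M.op (F i) := by
  classical
  ext ψ
  refine ext_inner_left ℂ fun φ => ?_
  have h := M.hasSum (fun i => if i ∈ s then F i else ∅)
    (fun i => by split_ifs <;> simp [hF]) (fun i j hij => by
      have := hd hij
      simp only [Function.onFun] at this ⊢
      split_ifs <;> simp [this]) φ ψ
  have e : (⋃ i, if i ∈ s then F i else ∅) = ⋃ i ∈ s, F i := by
    refine Set.iUnion_congr fun i => ?_
    split_ifs with hi <;> simp [hi]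
  rw [e] at h
  have h' : HasSum (fun i => ⟪φ, M.op (if i ∈ s then F i else ∅) ψ⟫_ℂ)
      (∑ i ∈ s, ⟪φ, M.op (if i ∈ s then F i else ∅) ψ⟫_ℂ) :=
    hasSum_sum_of_ne_finset_zero fun i hi => by simp [hi, M.op_empty]
  rw [h.unique h', sum_apply, inner_sum]
  exact Finset.sum_congr rfl fun i hi => by simp [hi]

/-- The complementary effect `1 - M(F) = M(Fᶜ)` is positive, so `0 ≤ M(F) ≤ 1`. -/
lemma POVM.norm_op_le_one [CompleteSpace E] (M : POVM Λ E) {F : Set Λ} (hF : MeasurableSet F) :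
    ‖M.op F‖ ≤ 1 := by
  have h : M.op F + M.op Fᶜ = ContinuousLinearMap.id ℂ E := by
    rw [← M.op_univ, ← Set.union_compl_self F]
    have := M.op_biUnion (F := fun i => if i = 0 then F else if i = 1 then Fᶜ else ∅)
      (fun i => by split_ifs <;> simp [hF]) (fun i j hij => by
        simp only [Function.onFun]
        split_ifs <;> first
          | exact absurd (‹i = _›.trans ‹j = _›.symm) hij
          | exact disjoint_compl_right
          | exact disjoint_compl_left
          | exact Set.disjoint_empty _
          | exact Set.empty_disjoint _) {0, 1}
    simpa using this.symm
  refine (CStarAlgebra.norm_le_one_iff_of_nonneg (M.op F)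
    ((ContinuousLinearMap.nonneg_iff_isPositive _).2 (M.isPositive F hF))).2 ?_
  rw [← sub_nonneg]
  have e : 1 - M.op F = M.op Fᶜ := sub_eq_of_eq_add' h.symm
  rw [e, ContinuousLinearMap.nonneg_iff_isPositive]
  exact M.isPositive _ hF.compl

end POVM

/-! ### σ-additivity of traces against product effects -/

section ProductEffects

variable {ι : Type*} [Fintype ι] [DecidableEq ι] {H : ι → Type u} [∀ i, NormedAddCommGroup (H i)]
  [∀ i, InnerProductSpace ℂ (H i)] [∀ i, CompleteSpace (H i)]

/-- `tr[D (⊗ X)]` is σ-additive when one factor is the value of a POV measure. -/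
lemma hasSum_trace_tensorOp {D : HTensor H →L[ℂ] HTensor H} (hD : IsTraceClass D)
    (X : ∀ i, H i →L[ℂ] H i) (i : ι) {Λ : Type*} [MeasurableSpace Λ] (M : POVM Λ (H i))
    {F : ℕ → Set Λ} (hF : ∀ i, MeasurableSet (F i)) (hd : Pairwise (Function.onFun Disjoint F)) :
    HasSum (fun k => trace (D ∘L tensorOp (Function.update X i (M.op (F k)))))
      (trace (D ∘L tensorOp (Function.update X i (M.op (⋃ k, F k))))) := by
  have hz : ∀ Y : ∀ i, H i →L[ℂ] H i, Y i = 0 → trace (D ∘L tensorOp Y) = 0 := by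
    intro Y hY
    simp [tensorOp_eq_zero Y i hY, trace]
  have hadd : ∀ A B : H i →L[ℂ] H i, trace (D ∘L tensorOp (Function.update X i (A + B))) =
      trace (D ∘L tensorOp (Function.update X i A)) +
      trace (D ∘L tensorOp (Function.update X i B)) := by
    intro A B
    have h1 := hD.hasSum_trace (tensorOp (Function.update X i A)) (.id ℂ _) (onb (HTensor H))
    have h2 := hD.hasSum_trace (tensorOp (Function.update X i B)) (.id ℂ _) (onb (HTensor H))
    have h3 := hD.hasSum_trace (tensorOp (Function.update X i (A + B))) (.id ℂ _) (onb (HTensor H))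
    simp only [ContinuousLinearMap.comp_id] at h1 h2 h3
    refine h3.unique ?_
    convert h1.add h2 using 1
    funext j
    rw [tensorOp_update_add]
    simp only [ContinuousLinearMap.id_apply, add_apply, map_add, inner_add_right]
  have hfin : ∀ s : Finset ℕ,
      ∑ k ∈ s, trace (D ∘L tensorOp (Function.update X i (M.op (F k)))) =
      trace (D ∘L tensorOp (Function.update X i (M.op (⋃ k ∈ s, F k)))) := by
    intro s
    rw [M.op_biUnion hF hd]
    induction s using Finset.induction_on with
    | empty => exact (hz _ (by simp)).symm
    | insert a s ha ih => rw [Finset.sum_insert ha, Finset.sum_insert ha, hadd, ih]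
  -- Each partial sum is the trace for one effect, that of a finite union, so the operators stay
  -- uniformly bounded and normality of the trace gives the limit.
  unfold HasSum
  simp_rw [hfin]
  refine hD.tendsto_trace (c := ∏ j ∈ Finset.univ.erase i, ‖X j‖) (fun s => ?_) ?_
  · refine (norm_tensorOp_le _).trans ?_
    rw [← Finset.mul_prod_erase _ _ (Finset.mem_univ i), Function.update_self]
    refine (mul_le_of_le_one_left (by positivity)
      (M.norm_op_le_one (s.measurableSet_biUnion fun k _ => hF k))).trans (le_of_eq ?_)
    refine Finset.prod_congr rfl fun j hj => ?_
    rw [Function.update_of_ne (Finset.ne_of_mem_erase hj)]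
  · refine tendsto_inner_tensorOp_update X i (c := 1)
      (fun s => M.norm_op_le_one (s.measurableSet_biUnion fun k _ => hF k)) fun x y => ?_
    have := M.hasSum F hF hd x y
    unfold HasSum at this
    simpa only [M.op_biUnion hF hd, sum_apply, inner_sum] using this

end ProductEffects

/-! ### Set functions on rectangles, σ-additive in each factor -/

section Multimeasure

open MeasureTheory

variable {Q : Type*} [DecidableEq Q] {X : Type*} [MeasurableSpace X]

/-- Nonnegative set functions on measurable rectangles that are σ-additive in each factor. -/
structure IsMultimeasure (Ψ : (Q → Set X) → ℝ) : Prop where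
  nonneg : ∀ F, (∀ q, MeasurableSet (F q)) → 0 ≤ Ψ F
  hasSum : ∀ F, (∀ q, MeasurableSet (F q)) → ∀ (q : Q) (G : ℕ → Set X),
    (∀ k, MeasurableSet (G k)) → Pairwise (Function.onFun Disjoint G) →
    HasSum (fun k => Ψ (Function.update F q (G k))) (Ψ (Function.update F q (⋃ k, G k)))

namespace IsMultimeasure

variable {Ψ : (Q → Set X) → ℝ}

lemma update_empty (h : IsMultimeasure Ψ) {F : Q → Set X} (hF : ∀ q, MeasurableSet (F q)) (q : Q) :
    Ψ (Function.update F q ∅) = 0 := by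
  have := (h.hasSum F hF q (fun _ => ∅) (fun _ => .empty)
    (fun _ _ _ => Set.disjoint_empty _)).summable
  exact (summable_const_iff _).1 this

lemma update_biUnion (h : IsMultimeasure Ψ) {F : Q → Set X} (hF : ∀ q, MeasurableSet (F q))
    (q : Q) {κ : Type*} (s : Finset κ) {G : κ → Set X} (hG : ∀ k, MeasurableSet (G k))
    (hd : Pairwise (Function.onFun Disjoint G)) :
    Ψ (Function.update F q (⋃ k ∈ s, G k)) = ∑ k ∈ s, Ψ (Function.update F q (G k)) := by
  have h2 : ∀ A B : Set X, MeasurableSet A → MeasurableSet B → Disjoint A B →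
      Ψ (Function.update F q (A ∪ B)) = Ψ (Function.update F q A) + Ψ (Function.update F q B) := by
    intro A B hA hB hAB
    have := h.hasSum F hF q (fun i => if i = 0 then A else if i = 1 then B else ∅)
      (fun i => by split_ifs <;> simp [hA, hB]) (fun i j hij => by
        simp only [Function.onFun]
        split_ifs <;> first
          | exact absurd (‹i = _›.trans ‹j = _›.symm) hij
          | exact hAB
          | exact hAB.symm
          | exact Set.disjoint_empty _
          | exact Set.empty_disjoint _)
    have e : (⋃ i : ℕ, if i = 0 then A else if i = 1 then B else ∅) = A ∪ B := by
      ext x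
      simp only [Set.mem_iUnion, Set.mem_union]
      constructor
      · rintro ⟨i, hi⟩
        split_ifs at hi
        · exact Or.inl hi
        · exact Or.inr hi
        · exact hi.elim
      · rintro (hx | hx)
        · exact ⟨0, by simpa using hx⟩
        · exact ⟨1, by simpa using hx⟩
    rw [e] at this
    have h' : HasSum
        (fun i : ℕ => Ψ (Function.update F q (if i = 0 then A else if i = 1 then B else ∅)))
        (∑ i ∈ {0, 1}, Ψ (Function.update F q (if i = 0 then A else if i = 1 then B else ∅))) :=
      hasSum_sum_of_ne_finset_zero fun i hi => by
        simp only [Finset.mem_insert, Finset.mem_singleton, not_or] at hi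
        simp [hi.1, hi.2, h.update_empty hF]
    rw [this.unique h']
    simp
  classical
  induction s using Finset.induction_on with
  | empty => simpa using h.update_empty hF q
  | insert a s ha ih =>
    rw [Finset.sum_insert ha, Finset.set_biUnion_insert, h2 _ _ (hG a)
      (s.measurableSet_biUnion fun k _ => hG k), ih]
    exact Set.disjoint_iUnion₂_right.2 fun k hk => hd fun e => ha (e ▸ hk)

/-- Two multimeasures agreeing on rectangles over a generating π-system containing the whole space
agree on all measurable rectangles. -/
lemma eq_of_generateFrom [Fintype Q] {Ψ' : (Q → Set X) → ℝ} (h : IsMultimeasure Ψ)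
    (h' : IsMultimeasure Ψ') {S : Set (Set X)} (hS : ‹MeasurableSpace X› = .generateFrom S)
    (hpi : IsPiSystem S) (huniv : Set.univ ∈ S)
    (heq : ∀ F, (∀ q, F q ∈ S) → Ψ F = Ψ' F) (F : Q → Set X) (hF : ∀ q, MeasurableSet (F q)) :
    Ψ F = Ψ' F := by
  have hm : ∀ A ∈ S, MeasurableSet A := fun A hA => by
    rw [hS]
    exact .basic A hA
  -- Factors in `s` are arbitrary measurable sets, the others still lie in the π-system. Each
  -- enlargement of `s` is a π-λ argument in one factor.
  have key : ∀ s : Finset Q, ∀ F : Q → Set X, (∀ q, MeasurableSet (F q)) →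
      (∀ q ∉ s, F q ∈ S) → Ψ F = Ψ' F := by
    intro s
    induction s using Finset.induction_on with
    | empty => exact fun F _ hF => heq F fun q => hF q (Finset.notMem_empty q)
    | insert q s _ ih =>
      intro F hF hFS
      have hb : ∀ t ∈ S, Ψ (Function.update F q t) = Ψ' (Function.update F q t) := by
        refine fun t ht => ih _ (fun p => ?_) fun p hp => ?_
        · by_cases hpq : p = q
          · subst hpq
            simpa using hm t ht
          · simpa [hpq] using hF p
        · by_cases hpq : p = q
          · subst hpq
            simpa using ht
          · simpa [hpq] using hFS p (by simp [hp, hpq])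
      have hcompl : ∀ {Φ : (Q → Set X) → ℝ}, IsMultimeasure Φ → ∀ t, MeasurableSet t →
          Φ (Function.update F q tᶜ) = Φ (Function.update F q Set.univ) -
            Φ (Function.update F q t) := by
        intro Φ hΦ t ht
        have := hΦ.update_biUnion hF q Finset.univ (G := fun b : Bool => if b then t else tᶜ)
          (fun b => by cases b <;> simp [ht]) (fun a b hab => by
            cases a <;> cases b <;> first
              | exact absurd rfl hab
              | exact disjoint_compl_right
              | exact disjoint_compl_left)
        simp only [Finset.mem_univ, Set.iUnion_true, Fintype.sum_bool, if_true,
          Bool.false_eq_true, if_false] at this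
        have e : (⋃ b : Bool, if b = true then t else tᶜ) = Set.univ := by
          refine Set.eq_univ_of_forall fun x => Set.mem_iUnion.2 ?_
          by_cases hx : x ∈ t
          · exact ⟨true, by simpa using hx⟩
          · exact ⟨false, by simpa using hx⟩
        rw [e] at this
        linarith
      have := MeasurableSpace.induction_on_inter (C := fun t _ =>
        Ψ (Function.update F q t) = Ψ' (Function.update F q t)) hS hpi
        (by rw [h.update_empty hF, h'.update_empty hF]) hb
        (fun t ht e => by rw [hcompl h t ht, hcompl h' t ht, e, hb _ huniv])
        (fun f hd hf e => by
          have h1 := h.hasSum F hF q f hf hd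
          simp only [e] at h1
          exact h1.unique (h'.hasSum F hF q f hf hd))
        (F q) (hF q)
      simpa using this
  exact key Finset.univ F hF fun q hq => absurd (Finset.mem_univ q) hq

lemma of_measure [Fintype Q] {Ω : Type*} [MeasurableSpace Ω] (ν : Measure Ω) [IsFiniteMeasure ν]
    {Z : Q → Ω → X} (hZ : ∀ q, Measurable (Z q)) :
    IsMultimeasure fun F => ν.real {ω | ∀ q, Z q ω ∈ F q} where
  nonneg _ _ := measureReal_nonneg
  hasSum F hF q G hG hd := by
    have hmeas : ∀ F : Q → Set X, (∀ q, MeasurableSet (F q)) →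
        MeasurableSet {ω | ∀ q, Z q ω ∈ F q} := by
      intro F hF
      rw [Set.ofPred_forall]
      exact MeasurableSet.iInter fun q => hZ q (hF q)
    have hu : ∀ A, MeasurableSet A → ∀ p, MeasurableSet (Function.update F q A p) := by
      intro A hA p
      by_cases hpq : p = q
      · subst hpq
        simpa using hA
      · simpa [hpq] using hF p
    have hset : ∀ A, {ω | ∀ p, Z p ω ∈ Function.update F q A p} =
        {ω | Z q ω ∈ A} ∩ {ω | ∀ p, p ≠ q → Z p ω ∈ F p} := by
      intro A
      ext ω
      constructor
      · exact fun h => ⟨by simpa using h q, fun p hp => by simpa [hp] using h p⟩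
      · rintro ⟨h1, h2⟩ p
        by_cases hpq : p = q
        · subst hpq
          simpa using h1
        · simpa [hpq] using h2 p hpq
    -- The signed measure attached to `ν` gives σ-additivity directly as a real-valued `HasSum`.
    have := ν.toSignedMeasure.m_iUnion (f := fun k => {ω | ∀ p, Z p ω ∈ Function.update F q (G k) p})
      (fun k => hmeas _ (hu _ (hG k))) (fun i j hij => by
        simp only [Function.onFun, hset]
        refine Disjoint.mono Set.inter_subset_left Set.inter_subset_left ?_
        exact (hd hij).preimage (Z q))
    have e : (⋃ k, {ω | ∀ p, Z p ω ∈ Function.update F q (G k) p}) =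
        {ω | ∀ p, Z p ω ∈ Function.update F q (⋃ k, G k) p} := by
      simp only [hset]
      rw [← Set.iUnion_inter]
      congr 1
      ext ω
      simp
    rw [e] at this
    simp only [VectorMeasure.coe_mk, Measure.toSignedMeasure] at this
    simpa only [hmeas _ (hu _ (hG _)), hmeas _ (hu _ (MeasurableSet.iUnion hG)), if_true] using this

end IsMultimeasure

end Multimeasure

/-! ### Cylinder sets in the Cantor space -/

section Cantor

/-- The cylinder of sequences extending a finite word. -/
def cell {n : ℕ} (e : Fin n → Bool) : Set (ℕ → Bool) := {x | ∀ i : Fin n, x i = e i}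

/-- The extension of a finite word by `false`. -/
def extendWord {n : ℕ} (e : Fin n → Bool) : ℕ → Bool := fun i => if h : i < n then e ⟨i, h⟩ else false

/-- Sets of sequences that depend only on the first `n` terms. -/
def DeterminedBy (n : ℕ) (A : Set (ℕ → Bool)) : Prop :=
  ∀ x y : ℕ → Bool, (∀ i < n, x i = y i) → (x ∈ A ↔ y ∈ A)

lemma extendWord_mem_cell {n : ℕ} (e e' : Fin n → Bool) : extendWord e ∈ cell e' ↔ e = e' := by
  simp [cell, extendWord, funext_iff]

lemma DeterminedBy.mono {m n : ℕ} (h : m ≤ n) {A : Set (ℕ → Bool)} (hA : DeterminedBy m A) :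
    DeterminedBy n A := fun x y hxy => hA x y fun i hi => hxy i (hi.trans_le h)

lemma determinedBy_cell {n : ℕ} (e : Fin n → Bool) : DeterminedBy n (cell e) := by
  intro x y h
  exact forall_congr' fun i => by rw [h i i.2]

lemma determinedBy_univ (n : ℕ) : DeterminedBy n Set.univ := fun _ _ _ => by simp

lemma DeterminedBy.eq_preimage {n : ℕ} {A : Set (ℕ → Bool)} (hA : DeterminedBy n A) :
    A = (fun (x : ℕ → Bool) (i : Fin n) => x i) ⁻¹' {e | extendWord e ∈ A} := by
  ext x
  refine hA _ _ fun i hi => ?_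
  simp [extendWord, hi]

lemma DeterminedBy.eq_biUnion {n : ℕ} {A : Set (ℕ → Bool)} (hA : DeterminedBy n A)
    [DecidablePred fun e : Fin n → Bool => extendWord e ∈ A] :
    A = ⋃ e ∈ Finset.univ.filter fun e : Fin n → Bool => extendWord e ∈ A, cell e := by
  ext x
  simp only [Finset.mem_filter, Finset.mem_univ, true_and, Set.mem_iUnion, exists_prop]
  constructor
  · intro hx
    exact ⟨fun i => x i, by rw [hA.eq_preimage] at hx; exact hx, fun i => rfl⟩
  · rintro ⟨e, he, hx⟩
    rw [hA.eq_preimage]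
    have : (fun i : Fin n => x i) = e := funext hx
    simpa [this] using he

lemma DeterminedBy.isClopen {n : ℕ} {A : Set (ℕ → Bool)} (hA : DeterminedBy n A) : IsClopen A := by
  rw [hA.eq_preimage]
  exact (isClopen_discrete _).preimage (by fun_prop)

lemma DeterminedBy.measurableSet {n : ℕ} {A : Set (ℕ → Bool)} (hA : DeterminedBy n A) :
    MeasurableSet A := by
  rw [hA.eq_preimage]
  exact (Set.toFinite _).measurableSet.preimage (by fun_prop)

lemma measurableSet_cell {n : ℕ} (e : Fin n → Bool) : MeasurableSet (cell e) :=
  (determinedBy_cell e).measurableSet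

lemma pairwise_disjoint_cell (n : ℕ) :
    Pairwise (Function.onFun Disjoint (cell : (Fin n → Bool) → Set (ℕ → Bool))) := by
  intro e e' h
  rw [Function.onFun, Set.disjoint_left]
  exact fun x hx hx' => h (funext fun i => (hx i).symm.trans (hx' i))

lemma isPiSystem_determinedBy : IsPiSystem {A : Set (ℕ → Bool) | ∃ n, DeterminedBy n A} := by
  rintro A ⟨m, hA⟩ B ⟨n, hB⟩ -
  exact ⟨max m n, fun x y h => and_congr (hA.mono (le_max_left _ _) x y h)
    (hB.mono (le_max_right _ _) x y h)⟩

lemma generateFrom_determinedBy :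
    (MeasurableSpace.pi : MeasurableSpace (ℕ → Bool)) =
      .generateFrom {A | ∃ n, DeterminedBy n A} := by
  refine le_antisymm (iSup_le fun i => ?_) (MeasurableSpace.generateFrom_le ?_)
  · rintro _ ⟨s, -, rfl⟩
    refine .basic _ ⟨i + 1, fun x y h => ?_⟩
    simp [h i (Nat.lt_succ_self i)]
  · rintro A ⟨n, hA⟩
    exact hA.measurableSet

/-- A multimeasure of a rectangle of sets determined by the first `n` terms is the sum of its values
on the rectangles of cylinders contained in it. -/
lemma IsMultimeasure.eq_sum_cells {Q : Type*} [Fintype Q] [DecidableEq Q]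
    {Ψ : (Q → Set (ℕ → Bool)) → ℝ} (h : IsMultimeasure Ψ) {n : ℕ} (F : Q → Set (ℕ → Bool))
    (hF : ∀ q, DeterminedBy n (F q)) :
    Ψ F = ∑ c : Q → Fin n → Bool,
      (∏ q, (F q).indicator 1 (extendWord (c q))) * Ψ fun q => cell (c q) := by
  classical
  -- Factors outside `s` are single cylinders; the factors in `s` are split into cylinders one at a
  -- time.
  have key : ∀ s : Finset Q, ∀ F : Q → Set (ℕ → Bool), (∀ q, DeterminedBy n (F q)) →
      (∀ q ∉ s, ∃ e : Fin n → Bool, F q = cell e) → Ψ F = ∑ c : Q → Fin n → Bool,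
      (∏ q, (F q).indicator 1 (extendWord (c q))) * Ψ fun q => cell (c q) := by
    intro s
    induction s using Finset.induction_on with
    | empty =>
      intro F _ hF
      choose c hc using fun q => hF q (Finset.notMem_empty q)
      obtain rfl : F = fun q => cell (c q) := funext hc
      rw [Finset.sum_eq_single c]
      · simp [extendWord_mem_cell]
      · intro d _ hd
        obtain ⟨q, hq⟩ := Function.ne_iff.1 hd
        rw [Finset.prod_eq_zero (Finset.mem_univ q), zero_mul]
        simp [extendWord_mem_cell, hq]
      · simp
    | insert q s _ ih =>
      intro F hF hFs
      have h1 : Ψ F = ∑ e : Fin n → Bool,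
          (F q).indicator 1 (extendWord e) * Ψ (Function.update F q (cell e)) := by
        have := h.update_biUnion (fun q => (hF q).measurableSet) q
          (Finset.univ.filter fun e : Fin n → Bool => extendWord e ∈ F q)
          measurableSet_cell (pairwise_disjoint_cell n)
        rw [← (hF q).eq_biUnion, Function.update_eq_self, Finset.sum_filter] at this
        rw [this]
        refine Finset.sum_congr rfl fun e _ => ?_
        by_cases he : extendWord e ∈ F q <;> simp [he]
      have h2 : ∀ e : Fin n → Bool, Ψ (Function.update F q (cell e)) =
          ∑ c : Q → Fin n → Bool, (∏ p, (Function.update F q (cell e) p).indicator 1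
            (extendWord (c p))) * Ψ fun q => cell (c q) := by
        intro e
        refine ih _ (fun p => ?_) fun p hp => ?_
        · by_cases hpq : p = q
          · subst hpq
            simpa using determinedBy_cell e
          · simpa [hpq] using hF p
        · by_cases hpq : p = q
          · subst hpq
            exact ⟨e, by simp⟩
          · simpa [hpq] using hFs p (by simp [hp, hpq])
      rw [h1]
      simp_rw [h2, Finset.mul_sum]
      rw [Finset.sum_comm]
      refine Finset.sum_congr rfl fun c _ => ?_
      rw [Finset.sum_eq_single (c q)]
      · rw [← mul_assoc, ← Finset.mul_prod_erase _ _ (Finset.mem_univ q),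
          ← Finset.mul_prod_erase _ _ (Finset.mem_univ q)]
        have e1 : (Function.update F q (cell (c q)) q).indicator (1 : (ℕ → Bool) → ℝ)
            (extendWord (c q)) = 1 := by
          simp [extendWord_mem_cell]
        rw [e1, one_mul]
        congr 2
        refine Finset.prod_congr rfl fun p hp => ?_
        rw [Function.update_of_ne (Finset.ne_of_mem_erase hp)]
      · intro e _ he
        rw [Finset.prod_eq_zero (Finset.mem_univ q), zero_mul, mul_zero]
        simp [extendWord_mem_cell, he.symm]
      · simp
  exact key Finset.univ F hF fun q hq => absurd (Finset.mem_univ q) hq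

end Cantor

/-! ### Gluing multimeasures with a common marginal -/

section Gluing

open MeasureTheory

/-- Finitely many nonnegative weights `w b a e` with common marginal `σ a` are glued, conditionally
independently given `a`, to a joint weight. -/
lemma exists_glued_weight {A B E : Type*} [Fintype B] [Fintype E] [DecidableEq B] [DecidableEq E]
    (w : B → A → E → ℝ) (σ : A → ℝ) (hw : ∀ b a e, 0 ≤ w b a e)
    (hσ : ∀ b a, ∑ e, w b a e = σ a) (b₀ : B) :
    ∃ W : A → (B → E) → ℝ, (∀ a β, 0 ≤ W a β) ∧
      ∀ b a e, ∑ β : B → E, (if β b = e then W a β else 0) = w b a e := by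
  have hσ0 : ∀ a, 0 ≤ σ a := fun a => by
    rw [← hσ b₀]
    exact Finset.sum_nonneg fun e _ => hw _ _ _
  refine ⟨fun a β => σ a * ∏ b, w b a (β b) / σ a, fun a β =>
    mul_nonneg (hσ0 a) (Finset.prod_nonneg fun b _ => div_nonneg (hw _ _ _) (hσ0 a)), ?_⟩
  intro b a e
  -- If `σ a = 0`, all weights over `a` vanish, so the value zero of the glued weight is correct.
  rcases eq_or_ne (σ a) 0 with h0 | h0
  · have : w b a e = 0 := by
      have h1 := hσ b a
      rw [h0] at h1
      exact (Finset.sum_eq_zero_iff_of_nonneg fun e _ => hw _ _ _).1 h1 e (Finset.mem_univ e)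
    simp [h0, this]
  · have h1 : ∀ β : B → E, (if β b = e then σ a * ∏ b', w b' a (β b') / σ a else 0) =
        σ a * ∏ b', (if b' = b ∧ β b' ≠ e then 0 else w b' a (β b') / σ a) := by
      intro β
      split_ifs with h
      · congr 1
        refine Finset.prod_congr rfl fun b' _ => ?_
        rw [if_neg]
        rintro ⟨rfl, h'⟩
        exact h' h
      · rw [Finset.prod_eq_zero (Finset.mem_univ b), mul_zero]
        rw [if_pos ⟨rfl, h⟩]
    simp_rw [h1]
    rw [← Finset.mul_sum]
    have h2 := Finset.prod_univ_sum (fun _ : B => (Finset.univ : Finset E))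
      (fun b' e' => if b' = b ∧ e' ≠ e then 0 else w b' a e' / σ a)
    rw [Fintype.piFinset_univ] at h2
    rw [← h2, ← Finset.mul_prod_erase _ _ (Finset.mem_univ b), Finset.prod_eq_one]
    · rw [Finset.sum_eq_single e]
      · simp
        field_simp
      · intro e' _ he'
        simp [he']
      · simp
    · intro b' hb'
      have := Finset.ne_of_mem_erase hb'
      simp only [this, false_and, if_false]
      rw [← Finset.sum_div, hσ, div_self h0]

/-- Sequences of finite measures of the same mass on a compact space have a limit measure whose
values on clopen sets are the eventual values of the sequence, where these exist. -/
lemma exists_measure_of_eventually_eq {K : Type*} [TopologicalSpace K] [T2Space K] [CompactSpace K]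
    [MeasurableSpace K] [BorelSpace K] (ν : ℕ → Measure K) [∀ n, IsFiniteMeasure (ν n)] (t : ℝ)
    (ht : ∀ n, (ν n).real Set.univ = t) :
    ∃ μ : Measure K, IsFiniteMeasure μ ∧ ∀ (S : Set K) (a : ℝ), IsClopen S →
      (∀ᶠ n in Filter.atTop, (ν n).real S = a) → μ.real S = a := by
  let P : ℕ → FiniteMeasure K := fun n => ⟨ν n, inferInstance⟩
  have hP : ∀ n, P n ∈ {μ : FiniteMeasure K | μ.mass = t.toNNReal} := by
    intro n
    rw [← ht n]
    exact (Real.toNNReal_coe (r := (P n).mass)).symm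
  -- A limit along a free ultrafilter: compactness suffices, and no convergent subsequence has to be
  -- chosen.
  obtain ⟨μ, -, hμ⟩ := (isCompact_setOfPred_finiteMeasure_eq_of_compactSpace K
    t.toNNReal).ultrafilter_le_nhds ((Filter.hyperfilter ℕ).map P) (by
      rw [Ultrafilter.coe_map, Filter.le_principal_iff, Filter.mem_map]
      exact Filter.univ_mem' hP)
  refine ⟨μ, inferInstance, fun S a hS ha => ?_⟩
  -- The indicator of a clopen set is continuous, so weak convergence applies to it.
  have h1 := (FiniteMeasure.tendsto_iff_forall_integral_tendsto (F := (Filter.hyperfilter ℕ : Filter ℕ))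
    (μs := P) (μ := μ)).1 hμ
    (BoundedContinuousFunction.mkOfCompact ⟨S.indicator (1 : K → ℝ),
      hS.continuous_indicator continuous_const⟩)
  simp only [BoundedContinuousFunction.mkOfCompact_apply, ContinuousMap.coe_mk] at h1
  rw [integral_indicator_one hS.isOpen.measurableSet] at h1
  simp_rw [integral_indicator_one hS.isOpen.measurableSet] at h1
  refine tendsto_nhds_unique h1 (tendsto_const_nhds.congr' ?_)
  refine Filter.Eventually.filter_mono (Nat.hyperfilter_le_atTop) ?_
  filter_upwards [ha] with n hn using hn.symm

variable {Q : Type*} [DecidableEq Q] (q₀ : Q) {B : Type*}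

/-- The coordinate at `q`, where the coordinate at `q₀` is that of the setting `b`. -/
def settingCoord {Y : Type*} (b : B) (q : Q) (z : ({q : Q // q ≠ q₀} → Y) × (B → Y)) : Y :=
  if h : q = q₀ then z.2 b else z.1 ⟨q, h⟩

lemma measurable_settingCoord (b : B) (q : Q) :
    Measurable (settingCoord q₀ b q : ({q : Q // q ≠ q₀} → ℕ → Bool) × (B → ℕ → Bool) → _) := by
  unfold settingCoord
  split_ifs <;> fun_prop

lemma continuous_settingCoord (b : B) (q : Q) :
    Continuous (settingCoord q₀ b q : ({q : Q // q ≠ q₀} → ℕ → Bool) × (B → ℕ → Bool) → _) := by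
  unfold settingCoord
  split_ifs <;> fun_prop

variable [Fintype Q] [Fintype B] [DecidableEq B]

/-- At resolution `n` only finitely many words matter. The glued weights are placed as point masses
at the words extended by `false`; a set determined by `n` terms cannot distinguish this point from
the rest of its cylinder. -/
lemma exists_measure_determinedBy {Ψ : B → (Q → Set (ℕ → Bool)) → ℝ}
    (hΨ : ∀ b, IsMultimeasure (Ψ b)) (hB : ∀ b b' F, (∀ q, MeasurableSet (F q)) →
      F q₀ = Set.univ → Ψ b F = Ψ b' F) (b₀ : B) (n : ℕ) :
    ∃ ν : Measure (({q : Q // q ≠ q₀} → ℕ → Bool) × (B → ℕ → Bool)), IsFiniteMeasure ν ∧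
      ∀ b F, (∀ q, DeterminedBy n (F q)) →
        ν.real {z | ∀ q, settingCoord q₀ b q z ∈ F q} = Ψ b F := by
  set A := {q : Q // q ≠ q₀} → Fin n → Bool
  set E := Fin n → Bool
  let join : A → E → Q → E := fun a e q => if h : q = q₀ then e else a ⟨q, h⟩
  have hjoin : ∀ a e e', (fun q => cell (join a e q)) =
      Function.update (fun q => cell (join a e' q)) q₀ (cell e) := by
    intro a e e'
    funext q
    by_cases h : q = q₀
    · subst h
      simp [join]
    · simp [join, h]
  have hmeas : ∀ (a : A) (e : E) q, MeasurableSet (cell (join a e q)) :=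
    fun a e q => measurableSet_cell _
  let e₀ : E := fun _ => false
  let σ : A → ℝ := fun a =>
    Ψ b₀ (Function.update (fun q => cell (join a e₀ q)) q₀ Set.univ)
  obtain ⟨W, hW0, hW⟩ := exists_glued_weight (fun b a e => Ψ b fun q => cell (join a e q)) σ
    (fun b a e => (hΨ b).nonneg _ (hmeas a e)) (fun b a => by
      simp only [σ]
      -- Summing over the cylinders at `q₀` replaces that factor by the whole space, where `hB`
      -- removes the dependence on `b`: the weights have the common marginal `σ`.
      have hu : (Set.univ : Set (ℕ → Bool)) = ⋃ e ∈ (Finset.univ : Finset E), cell e := by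
        classical
        simpa using (determinedBy_univ n).eq_biUnion
      rw [hB b₀ b _ (fun q => ?_) (by simp), hu, (hΨ b).update_biUnion (hmeas a e₀) q₀ _
        measurableSet_cell (pairwise_disjoint_cell n)]
      · exact Finset.sum_congr rfl fun e _ => congrArg _ (hjoin a e e₀)
      · by_cases hq : q = q₀
        · subst hq
          simp
        · simpa [hq] using hmeas a e₀ q) b₀
  let pt : A → (B → E) → ({q : Q // q ≠ q₀} → ℕ → Bool) × (B → ℕ → Bool) :=
    fun a β => (fun q => extendWord (a q), fun b => extendWord (β b))
  refine ⟨∑ p : A × (B → E), ENNReal.ofReal (W p.1 p.2) • Measure.dirac (pt p.1 p.2), ?_, ?_⟩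
  · refine ⟨?_⟩
    rw [Measure.finsetSum_apply]
    simp
  intro b F hF
  have hS : MeasurableSet {z : ({q : Q // q ≠ q₀} → ℕ → Bool) × (B → ℕ → Bool) |
      ∀ q, settingCoord q₀ b q z ∈ F q} := by
    rw [Set.ofPred_forall]
    exact MeasurableSet.iInter fun q => measurable_settingCoord q₀ b q (hF q).measurableSet
  have hpt : ∀ a β q, settingCoord q₀ b q (pt a β) = extendWord (join a (β b) q) := by
    intro a β q
    simp only [settingCoord, join, pt]
    split_ifs <;> rfl
  have hind : ∀ a β, ({z : ({q : Q // q ≠ q₀} → ℕ → Bool) × (B → ℕ → Bool) |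
      ∀ q, settingCoord q₀ b q z ∈ F q}).indicator
        (1 : ({q : Q // q ≠ q₀} → ℕ → Bool) × (B → ℕ → Bool) → ℝ≥0∞) (pt a β) =
      ENNReal.ofReal (∏ q, (F q).indicator 1 (extendWord (join a (β b) q))) := by
    intro a β
    by_cases h : ∀ q, extendWord (join a (β b) q) ∈ F q
    · rw [Set.indicator_of_mem (by simpa [hpt] using h), Finset.prod_eq_one]
      · simp
      · exact fun q _ => by simp [h q]
    · rw [Set.indicator_of_notMem (by simpa [hpt] using h)]
      push Not at h
      obtain ⟨q, hq⟩ := h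
      rw [Finset.prod_eq_zero (Finset.mem_univ q) (by simp [hq]), ENNReal.ofReal_zero]
  have hnn : ∀ c : Q → E, 0 ≤ ∏ q, (F q).indicator (1 : (ℕ → Bool) → ℝ) (extendWord (c q)) := fun c =>
    Finset.prod_nonneg fun q _ => Set.indicator_nonneg (fun _ _ => zero_le_one) _
  rw [measureReal_def, Measure.finsetSum_apply, ENNReal.toReal_sum (fun p _ => by
    simp only [Measure.smul_apply, smul_eq_mul, Measure.dirac_apply' _ hS, hind]
    exact ENNReal.mul_ne_top ENNReal.ofReal_ne_top ENNReal.ofReal_ne_top)]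
  simp only [Measure.smul_apply, smul_eq_mul, Measure.dirac_apply' _ hS, hind, ENNReal.toReal_mul,
    ENNReal.toReal_ofReal (hW0 _ _), ENNReal.toReal_ofReal (hnn _)]
  rw [Fintype.sum_prod_type, (hΨ b).eq_sum_cells F hF, ← (Equiv.funSplitAt q₀ E).symm.sum_comp,
    Fintype.sum_prod_type_right]
  refine Finset.sum_congr rfl fun a _ => ?_
  have hsp : ∀ e, (Equiv.funSplitAt q₀ E).symm (e, a) = join a e := by
    intro e
    funext q
    simp only [Equiv.funSplitAt, Equiv.piSplitAt, Equiv.coe_fn_symm_mk, join]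
    split_ifs with h
    · subst h
      rfl
    · rfl
  simp_rw [hsp, ← hW b a, Finset.mul_sum]
  rw [Finset.sum_comm]
  refine Finset.sum_congr rfl fun β _ => ?_
  rw [Finset.sum_eq_single (β b)]
  · simp [mul_comm]
  · intro e _ he
    simp [he.symm]
  · simp

/-- Positive multimeasures `Ψ b` that do not depend on `b` when the factor at `q₀` is the whole
space are the marginals of one positive measure. -/
theorem exists_glued_measure {Ψ : B → (Q → Set (ℕ → Bool)) → ℝ}
    (hΨ : ∀ b, IsMultimeasure (Ψ b)) (hB : ∀ b b' F, (∀ q, MeasurableSet (F q)) →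
      F q₀ = Set.univ → Ψ b F = Ψ b' F) (b₀ : B) :
    ∃ ν : Measure (({q : Q // q ≠ q₀} → ℕ → Bool) × (B → ℕ → Bool)), IsFiniteMeasure ν ∧
      ∀ b F, (∀ q, MeasurableSet (F q)) →
        ν.real {z | ∀ q, settingCoord q₀ b q z ∈ F q} = Ψ b F := by
  choose ν hν hνΨ using exists_measure_determinedBy q₀ hΨ hB b₀
  obtain ⟨μ, hμ, h⟩ := exists_measure_of_eventually_eq ν (Ψ b₀ fun _ => Set.univ) fun n => by
    simpa using hνΨ n b₀ (fun _ => Set.univ) fun _ => determinedBy_univ n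
  refine ⟨μ, hμ, fun b F hF => (IsMultimeasure.of_measure μ
    (measurable_settingCoord q₀ b)).eq_of_generateFrom (hΨ b) generateFrom_determinedBy
    isPiSystem_determinedBy ⟨0, determinedBy_univ 0⟩ (fun F hF => ?_) F hF⟩
  choose m hm using hF
  -- There are finitely many factors, so one word length determines them all; from there on every
  -- approximation has the exact value.
  have hd : ∀ q, DeterminedBy (Finset.univ.sup m) (F q) :=
    fun q => (hm q).mono (Finset.le_sup (Finset.mem_univ q))
  refine h _ _ ?_ (Filter.eventually_atTop.2 ⟨Finset.univ.sup m, fun n hn =>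
    hνΨ n b F fun q => (hd q).mono hn⟩)
  rw [Set.ofPred_forall]
  exact isClopen_iInter_of_finite fun q => (hd q).isClopen.preimage (continuous_settingCoord q₀ b q)

end Gluing

/-! ### The lower bound by one -/

section LowerBound

open MeasureTheory

/-- The trivial POV measure with one outcome. -/
noncomputable def trivialPOVM (E : Type*) [NormedAddCommGroup E] [InnerProductSpace ℂ E] :
    POVM PUnit.{v + 1} E where
  op F := F.indicator (fun _ => ContinuousLinearMap.id ℂ E) PUnit.unit
  isPositive F _ := by
    by_cases h : PUnit.unit ∈ F
    · rw [Set.indicator_of_mem h]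
      exact ContinuousLinearMap.isPositive_one
    · rw [Set.indicator_of_notMem h]
      exact ContinuousLinearMap.isPositive_zero
  op_univ := by simp
  hasSum F _ hd φ ψ := by
    by_cases h : PUnit.unit ∈ ⋃ i, F i
    · rw [Set.indicator_of_mem h]
      obtain ⟨i, hi⟩ := Set.mem_iUnion.1 h
      have := hasSum_single (f := fun k => ⟪φ, (F k).indicator
        (fun _ => ContinuousLinearMap.id ℂ E) PUnit.unit ψ⟫_ℂ) i fun k hk => by
          rw [Set.indicator_of_notMem fun hk' => Set.disjoint_left.1 (hd hk) hk' hi]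
          simp
      simpa only [Set.indicator_of_mem hi] using this
    · rw [Set.indicator_of_notMem h]
      have : ∀ i, PUnit.unit ∉ F i := fun i hi => h (Set.mem_iUnion.2 ⟨i, hi⟩)
      have e : ∀ i, (F i).indicator (fun _ => ContinuousLinearMap.id ℂ E) PUnit.unit = 0 :=
        fun i => Set.indicator_of_notMem (this i) _
      simp only [e, zero_apply, inner_zero_right]
      exact hasSum_zero

variable {N : ℕ} {H : Fin N → Type u} [∀ n, NormedAddCommGroup (H n)]
  [∀ n, InnerProductSpace ℂ (H n)]

/-- Normalization alone forces this; if no measure simulates the scenario, the infimum is `∞`. -/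
lemma one_le_scenarioParam (ρ : HTensor H →L[ℂ] HTensor H) {S : Fin N → ℕ}
    {Λ : Fin N → Type v} [∀ n, MeasurableSpace (Λ n)] (M : ∀ n, Fin (S n) → POVM (Λ n) (H n)) :
    1 ≤ scenarioParam ρ M := by
  refine le_iInf₂ fun μ hμ => ?_
  have := SignedMeasure.enorm_le_totalVariation μ Set.univ
  rwa [hμ.normalized, enorm_one] at this

/-- The supremum needs only one scenario, and one-point outcome spaces provide it. -/
lemma one_le_bellViolation (ρ : HTensor H →L[ℂ] HTensor H) (S : Fin N → ℕ) :
    1 ≤ bellViolation.{u, v} ρ S := by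
  refine (one_le_scenarioParam ρ fun n (_ : Fin (S n)) => trivialPOVM.{v} (H n)).trans ?_
  unfold bellViolation bellViolationOn
  exact le_iSup_of_le (fun _ => PUnit.{v + 1}) <| le_iSup_of_le (fun _ => inferInstance) <|
    le_iSup_of_le (fun _ => inferInstance) <|
    le_iSup (fun M : ∀ n, Fin (S n) → POVM PUnit.{v + 1} (H n) => scenarioParam ρ M) _

end LowerBound

/-! ### The covering norm is at most the trace norm -/

section CoveringTraceNorm

section

variable {K : Type*} [NormedAddCommGroup K] [InnerProductSpace ℂ K] [CompleteSpace K]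

lemma IsTraceClass.abs {T : K →L[ℂ] K} (hT : IsTraceClass T) : IsTraceClass (CFC.abs T) := by
  unfold IsTraceClass traceNorm
  rw [CFC.cfcAbs_cfcAbs]
  exact hT

lemma ofReal_trace_abs {T : K →L[ℂ] K} (hT : IsTraceClass T) :
    ENNReal.ofReal (trace (CFC.abs T)).re = traceNorm T := by
  have hpos : ∀ i, 0 ≤ (⟪onb K i, CFC.abs T (onb K i)⟫_ℂ).re := fun i =>
    (Complex.le_def.1 (((ContinuousLinearMap.nonneg_iff_isPositive _).1
      (CFC.abs_nonneg T)).inner_nonneg_right _)).1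
  have hs : HasSum (fun i => ⟪onb K i, CFC.abs T (onb K i)⟫_ℂ) (trace (CFC.abs T)) := by
    simpa using hT.abs.hasSum_trace (.id ℂ _) (.id ℂ _) (onb K)
  have hs' : HasSum (fun i => (⟪onb K i, CFC.abs T (onb K i)⟫_ℂ).re) (trace (CFC.abs T)).re :=
    Complex.hasSum_re hs
  rw [← hs'.tsum_eq, ENNReal.ofReal_tsum_of_nonneg hpos hs'.summable]
  rfl

end

variable {ι : Type*} [Fintype ι] {G : ι → Type u} [∀ i, NormedAddCommGroup (G i)]
  [∀ i, InnerProductSpace ℂ (G i)]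

lemma tensorPositive_of_isPositive {Z : HTensor G →L[ℂ] HTensor G} (h : Z.IsPositive) :
    TensorPositive Z := fun ψ => by
  have := Complex.le_def.1 (h.inner_nonneg_right (HTensor.tmul ψ))
  exact ⟨this.1, this.2.symm⟩

/-- `|T|` is a covering, since `|T| + T = 2T⁺` and `|T| - T = 2T⁻` are positive, and its trace is
the trace norm. -/
lemma coveringNorm_le_traceNorm {T : HTensor G →L[ℂ] HTensor G} (hT : IsSelfAdjoint T) :
    coveringNorm T ≤ traceNorm T := by
  by_cases htc : IsTraceClass T
  · have hp : ∀ {Z : HTensor G →L[ℂ] HTensor G}, 0 ≤ Z → TensorPositive Z := fun hZ =>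
      tensorPositive_of_isPositive ((ContinuousLinearMap.nonneg_iff_isPositive _).1 hZ)
    have hcov : IsCovering T (CFC.abs T) := by
      refine ⟨hp (CFC.abs_nonneg T), hp ?_, hp ?_⟩
      · rw [CFC.abs_add_self T hT]
        exact nsmul_nonneg (CFC.posPart_nonneg T) 2
      · rw [CFC.abs_sub_self T hT]
        exact nsmul_nonneg (CFC.negPart_nonneg T) 2
    refine (iInf₂_le (CFC.abs T) htc.abs).trans ((iInf_le _ hcov).trans ?_)
    exact (ofReal_trace_abs htc).le
  · rw [IsTraceClass, not_lt, top_le_iff] at htc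
    rw [htc]
    exact le_top

end CoveringTraceNorm

/-! ### From coverings of source operators to simulating measures -/

section UpperBound

open MeasureTheory
open scoped ComplexOrder

lemma IsTraceClass.neg {K : Type*} [NormedAddCommGroup K] [InnerProductSpace ℂ K] [CompleteSpace K]
    {T : K →L[ℂ] K} (hT : IsTraceClass T) : IsTraceClass (-T) := by
  unfold IsTraceClass traceNorm
  rw [CFC.abs_neg]
  exact hT

lemma trace_neg {K : Type*} [NormedAddCommGroup K] [InnerProductSpace ℂ K] [CompleteSpace K]
    (T : K →L[ℂ] K) : trace (-T) = -trace T := by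
  simp [trace, tsum_neg]

/-- For a Hahn set `i` the total variation is `(α - β)(i) - (α - β)(iᶜ)`; the terms `-β(i)` and
`-α(iᶜ)` only lower it. -/
lemma totalVariation_sub_le {Ω : Type*} [MeasurableSpace Ω] (α β : Measure Ω) [IsFiniteMeasure α]
    [IsFiniteMeasure β] :
    (α.toSignedMeasure - β.toSignedMeasure).totalVariation Set.univ ≤
      ENNReal.ofReal (α.real Set.univ + β.real Set.univ) := by
  obtain ⟨i, hi, hi2, hi3, hp, hn⟩ :=
    (α.toSignedMeasure - β.toSignedMeasure).toJordanDecomposition_spec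
  refine (ENNReal.le_ofReal_iff_toReal_le (measure_ne_top _ _) (by positivity)).2 ?_
  change (SignedMeasure.totalVariation _).real _ ≤ _
  rw [SignedMeasure.totalVariation, measureReal_add_apply, hp, hn,
    SignedMeasure.toMeasureOfZeroLE_real_apply _ _ _ .univ,
    SignedMeasure.toMeasureOfLEZero_real_apply _ _ _ .univ, Set.inter_univ, Set.inter_univ,
    Measure.toSignedMeasure_sub_apply hi, Measure.toSignedMeasure_sub_apply hi.compl,
    ← measureReal_add_measureReal_compl (μ := α) hi, ← measureReal_add_measureReal_compl (μ := β) hi]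
  have h1 : 0 ≤ β.real i := measureReal_nonneg
  have h2 : 0 ≤ α.real iᶜ := measureReal_nonneg
  linarith

/-- A tensor positive operator and POV measures at all factors define a multimeasure. -/
lemma TensorPositive.isMultimeasure {ι : Type*} [Fintype ι] [DecidableEq ι] {G : ι → Type u}
    [∀ i, NormedAddCommGroup (G i)] [∀ i, InnerProductSpace ℂ (G i)] [∀ i, CompleteSpace (G i)]
    {C T : HTensor G →L[ℂ] HTensor G} (hC : IsTraceClass C) (hT : IsTraceClass T)
    (h : TensorPositive (C + T)) {Λ : ι → Type*} [∀ i, MeasurableSpace (Λ i)]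
    (M : ∀ i, POVM (Λ i) (G i)) {X : Type*} [MeasurableSpace X] {j : ∀ i, Λ i → X}
    (hj : ∀ i, Measurable (j i)) :
    IsMultimeasure fun F : ι → Set X =>
      (trace (C ∘L tensorOp fun i => (M i).op (j i ⁻¹' F i)) +
        trace (T ∘L tensorOp fun i => (M i).op (j i ⁻¹' F i))).re / 2 where
  nonneg F hF := div_nonneg (Complex.le_def.1 (h.trace_nonneg hC hT _ fun i =>
    (M i).isPositive _ (hj i (hF i)))).1 zero_le_two
  hasSum F hF q A hA hd := by
    have e : ∀ B : Set X, (fun i => (M i).op (j i ⁻¹' Function.update F q B i)) =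
        Function.update (fun i => (M i).op (j i ⁻¹' F i)) q ((M q).op (j q ⁻¹' B)) := by
      intro B
      funext i
      by_cases hi : i = q
      · subst hi
        simp
      · simp [hi]
    simp only [e, Set.preimage_iUnion]
    have hd' : Pairwise (Function.onFun Disjoint fun k => j q ⁻¹' A k) :=
      fun k l hkl => (hd hkl).preimage _
    exact (Complex.reCLM.hasSum ((hasSum_trace_tensorOp hC _ q (M q) (fun k => hj q (hA k)) hd').add
      (hasSum_trace_tensorOp hT _ q (M q) (fun k => hj q (hA k)) hd'))).div_const 2

variable {N : ℕ} {S : Fin N → ℕ} (n₀ : Fin N)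

/-- The settings `s` as indices of copies when site `n₀` has only one copy. -/
def copyIndex (s : ∀ n, Fin (S n)) (n : Fin N) : Fin (Function.update S n₀ 1 n) :=
  if h : n = n₀ then ⟨0, by subst h; simp⟩ else Fin.cast (by simp [h]) (s n)

/-- The setting measured on a copy, when the setting `b` is measured on the copy at `n₀`. -/
def settingOf (b : Fin (S n₀)) (q : Σ n, Fin (Function.update S n₀ 1 n)) : Fin (S q.1) :=
  if h : q.1 = n₀ then Fin.cast (by rw [h]) b else Fin.cast (by simp [h]) q.2

lemma settingOf_copyIndex (s : ∀ n, Fin (S n)) (n : Fin N) :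
    settingOf n₀ (s n₀) ⟨n, copyIndex n₀ s n⟩ = s n := by
  unfold settingOf copyIndex
  by_cases h : n = n₀
  · subst h
    simp
  · simp [h]

/-- The only copy at site `n₀`. -/
def singleCopy : Σ n, Fin (Function.update S n₀ 1 n) := ⟨n₀, ⟨0, by simp⟩⟩

lemma eq_singleCopy {q : Σ n, Fin (Function.update S n₀ 1 n)} (h : q.1 = n₀) :
    q = singleCopy n₀ := by
  obtain ⟨n, k⟩ := q
  simp only at h
  subst h
  have : Subsingleton (Fin (Function.update S n 1 n)) := by
    rw [Function.update_self]
    infer_instance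
  unfold singleCopy
  congr 1
  exact Subsingleton.elim _ _

variable {Λ : Fin N → Type v}

/-- The outcomes of all settings from the outcomes at all copies away from `n₀` and the outcomes of
all settings at `n₀`. -/
def outcomeOf {X : Type*} (l : ∀ n, X → Λ n)
    (z : ({q : Σ n, Fin (Function.update S n₀ 1 n) // q ≠ singleCopy n₀} → X) ×
      (Fin (S n₀) → X)) : OutcomeSpace S Λ := fun p =>
  l p.1 (if h : p.1 = n₀ then z.2 (Fin.cast (by rw [h]) p.2) else
    z.1 ⟨⟨p.1, Fin.cast (by simp [h]) p.2⟩, fun e => h (congrArg Sigma.fst e)⟩)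

/-- Links the two labellings, so that a marginal event for the settings `s` pulls back to a
rectangle in the coordinates `settingCoord` of setting `s n₀`. -/
lemma outcomeOf_apply {X : Type*} (l : ∀ n, X → Λ n)
    (z : ({q : Σ n, Fin (Function.update S n₀ 1 n) // q ≠ singleCopy n₀} → X) ×
      (Fin (S n₀) → X)) (s : ∀ n, Fin (S n)) (n : Fin N) :
    outcomeOf n₀ l z ⟨n, s n⟩ =
      l n (settingCoord (singleCopy n₀) (s n₀) ⟨n, copyIndex n₀ s n⟩ z) := by
  unfold outcomeOf settingCoord
  congr 1
  by_cases h : n = n₀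
  · subst h
    rw [dif_pos rfl, dif_pos (eq_singleCopy n rfl)]
    rfl
  · rw [dif_neg h, dif_neg fun e => h (congrArg Sigma.fst e)]
    simp [copyIndex, h]

lemma measurable_outcomeOf [∀ n, MeasurableSpace (Λ n)] {X : Type*} [MeasurableSpace X]
    {l : ∀ n, X → Λ n} (hl : ∀ n, Measurable (l n)) :
    Measurable (outcomeOf (S := S) n₀ l) := by
  refine measurable_pi_iff.2 fun p => (hl p.1).comp ?_
  split_ifs <;> fun_prop

variable {H : Fin N → Type u} [∀ n, NormedAddCommGroup (H n)]
  [∀ n, InnerProductSpace ℂ (H n)]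

/-- The product operator with the effects `M n (s n) (F n)` on the copies `copyIndex n₀ s n`. -/
noncomputable def copyEffect [∀ n, MeasurableSpace (Λ n)] (M : ∀ n, Fin (S n) → POVM (Λ n) (H n))
    (s : ∀ n, Fin (S n)) (F : ∀ n, Set (Λ n)) :
    CopyTensor H (Function.update S n₀ 1) →L[ℂ] CopyTensor H (Function.update S n₀ 1) :=
  tensorOp fun p : (Σ n : Fin N, Fin (Function.update S n₀ 1 n)) =>
    if p.2 = copyIndex n₀ s p.1 then (M p.1 (s p.1)).op (F p.1) else ContinuousLinearMap.id ℂ (H p.1)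

lemma copyEffect_univ [∀ n, MeasurableSpace (Λ n)] (M : ∀ n, Fin (S n) → POVM (Λ n) (H n))
    (s : ∀ n, Fin (S n)) : copyEffect n₀ M s (fun _ => Set.univ) = ContinuousLinearMap.id ℂ _ := by
  unfold copyEffect
  rw [← tensorOp_id]
  congr 1
  funext p
  rw [(M p.1 (s p.1)).op_univ, ite_self]

variable [∀ n, CompleteSpace (H n)]

/-- A tensor positive operator on the copies yields a positive measure on the outcomes of all
settings. -/
lemma exists_measure_copyEffect [∀ n, MeasurableSpace (Λ n)] [∀ n, StandardBorelSpace (Λ n)]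
    [∀ n, Nonempty (Λ n)] (M : ∀ n, Fin (S n) → POVM (Λ n) (H n)) (b₀ : Fin (S n₀))
    {C T : CopyTensor H (Function.update S n₀ 1) →L[ℂ] CopyTensor H (Function.update S n₀ 1)}
    (hC : IsTraceClass C) (hT : IsTraceClass T) (h : TensorPositive (C + T)) :
    ∃ ν : Measure (OutcomeSpace S Λ), IsFiniteMeasure ν ∧
      ∀ (s : ∀ n, Fin (S n)) (F : ∀ n, Set (Λ n)), (∀ n, MeasurableSet (F n)) →
        ν.real {ω | ∀ n, ω ⟨n, s n⟩ ∈ F n} =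
          (trace (C ∘L copyEffect n₀ M s F) + trace (T ∘L copyEffect n₀ M s F)).re / 2 := by
  -- Each outcome space is embedded in the Cantor space with a measurable left inverse `l`, which
  -- needs it to be nonempty.
  choose j hj hji using fun n =>
    MeasurableSpace.measurable_injection_nat_bool_of_countablySeparated (Λ n)
  choose l hl hlj using fun n => ((hj n).measurableEmbedding (hji n)).exists_measurable_extend
    measurable_id fun _ => inferInstance
  obtain ⟨ν, hν, hνΨ⟩ := exists_glued_measure (singleCopy n₀)
    (fun b : Fin (S n₀) => h.isMultimeasure hC hT
      (fun q : (Σ n, Fin (Function.update S n₀ 1 n)) => M q.1 (settingOf n₀ b q))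
      (j := fun q => j q.1) fun q => hj q.1)
    (fun b b' F _ hF => by
      have : (fun q : (Σ n, Fin (Function.update S n₀ 1 n)) =>
          (M q.1 (settingOf n₀ b q)).op (j q.1 ⁻¹' F q)) =
          fun q => (M q.1 (settingOf n₀ b' q)).op (j q.1 ⁻¹' F q) := by
        funext q
        by_cases hq : q.1 = n₀
        · rw [eq_singleCopy n₀ hq, hF, Set.preimage_univ, POVM.op_univ, POVM.op_univ]
        · simp [settingOf, hq]
      simp only [this]) b₀
  refine ⟨ν.map (outcomeOf n₀ l), inferInstance, fun s F hF => ?_⟩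
  have hS : MeasurableSet {ω : OutcomeSpace S Λ | ∀ n, ω ⟨n, s n⟩ ∈ F n} := by
    rw [Set.ofPred_forall]
    exact MeasurableSet.iInter fun n => measurable_pi_apply _ (hF n)
  rw [map_measureReal_apply (measurable_outcomeOf n₀ hl) hS]
  -- Copies not selected by `s` get the whole space, hence the identity effect. On selected copies
  -- `l ∘ j = id` recovers `F n`.
  let F' : (Σ n, Fin (Function.update S n₀ 1 n)) → Set (ℕ → Bool) := fun q =>
    if q.2 = copyIndex n₀ s q.1 then l q.1 ⁻¹' F q.1 else Set.univ
  have hpre : outcomeOf n₀ l ⁻¹' {ω : OutcomeSpace S Λ | ∀ n, ω ⟨n, s n⟩ ∈ F n} =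
      {z | ∀ q, settingCoord (singleCopy n₀) (s n₀) q z ∈ F' q} := by
    ext z
    simp only [Set.mem_preimage, Set.mem_ofPred_eq, outcomeOf_apply]
    constructor
    · rintro hz ⟨n, k⟩
      by_cases hk : k = copyIndex n₀ s n
      · subst hk
        simpa [F'] using hz n
      · simp [F', hk]
    · intro hz n
      simpa [F'] using hz ⟨n, copyIndex n₀ s n⟩
  have hop : (tensorOp fun q : (Σ n, Fin (Function.update S n₀ 1 n)) =>
      (M q.1 (settingOf n₀ (s n₀) q)).op (j q.1 ⁻¹' F' q)) = copyEffect n₀ M s F := by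
    unfold copyEffect
    congr 1
    funext ⟨n, k⟩
    by_cases hk : k = copyIndex n₀ s n
    · subst hk
      have : j n ⁻¹' (l n ⁻¹' F n) = F n := by
        rw [← Set.preimage_comp, hlj n, Set.preimage_id]
      simp [F', settingOf_copyIndex, this]
    · simp [F', hk, POVM.op_univ]
  rw [hpre, hνΨ (s n₀) F' fun q => ?_]
  · simp only [hop]
  · simp only [F']
    split_ifs
    · exact hl _ (hF _)
    · exact .univ

-- An empty outcome space would give `1 = M(∅) = 0` on one factor, hence on the whole tensor
-- product, contradicting `tr ρ = 1`.
omit [∀ n, CompleteSpace (H n)] in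
lemma IsState.nonempty_outcomes {ρ : HTensor H →L[ℂ] HTensor H} (hρ : IsState ρ) {n : Fin N}
    {L : Type*} [MeasurableSpace L] (M : POVM L (H n)) : Nonempty L := by
  by_contra hL
  rw [not_nonempty_iff] at hL
  have h0 : ContinuousLinearMap.id ℂ (H n) = 0 := by
    rw [← M.op_univ, Set.univ_eq_empty_iff.2 hL, M.op_empty]
  have h1 := hρ.trace_eq_one
  rw [← ContinuousLinearMap.comp_id ρ, ← tensorOp_id, tensorOp_eq_zero _ n h0] at h1
  simp [trace] at h1

/-- Every covering of a source operator bounds the scenario parameters. -/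
lemma scenarioParam_le_of_isCovering {ρ : HTensor H →L[ℂ] HTensor H} (hρ : IsState ρ)
    (hS : ∀ n, 1 ≤ S n) [∀ n, MeasurableSpace (Λ n)] [∀ n, StandardBorelSpace (Λ n)]
    (M : ∀ n, Fin (S n) → POVM (Λ n) (H n))
    {T C : CopyTensor H (Function.update S n₀ 1) →L[ℂ] CopyTensor H (Function.update S n₀ 1)}
    (hT : IsSourceOperator ρ (Function.update S n₀ 1) T) (hC : IsTraceClass C)
    (hTC : IsCovering T C) : scenarioParam ρ M ≤ ENNReal.ofReal (trace C).re := by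
  let s₀ : ∀ n, Fin (S n) := fun n => ⟨0, hS n⟩
  have : ∀ n, Nonempty (Λ n) := fun n => hρ.nonempty_outcomes (M n (s₀ n))
  obtain ⟨α, _, hα⟩ := exists_measure_copyEffect n₀ M (s₀ n₀) hC hT.isTraceClass hTC.add
  obtain ⟨β, _, hβ⟩ := exists_measure_copyEffect n₀ M (s₀ n₀) hC hT.isTraceClass.neg (by
    rw [← sub_eq_add_neg]
    exact hTC.sub)
  simp only [ContinuousLinearMap.neg_comp, trace_neg] at hβ
  have hmarg : ∀ (s : ∀ n, Fin (S n)) (F : ∀ n, Set (Λ n)), (∀ n, MeasurableSet (F n)) →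
      (((α.toSignedMeasure - β.toSignedMeasure) {ω | ∀ n, ω ⟨n, s n⟩ ∈ F n} : ℝ) : ℂ) =
        jointProb ρ M s F := by
    intro s F hF
    have hm : MeasurableSet {ω : OutcomeSpace S Λ | ∀ n, ω ⟨n, s n⟩ ∈ F n} := by
      rw [Set.ofPred_forall]
      exact MeasurableSet.iInter fun n => measurable_pi_apply _ (hF n)
    have hj : trace (T ∘L copyEffect n₀ M s F) = jointProb ρ M s F :=
      hT.trace_eq (copyIndex n₀ s) fun n => (M n (s n)).op (F n)
    have hpos : ∀ p : (Σ n : Fin N, Fin (Function.update S n₀ 1 n)),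
        (if p.2 = copyIndex n₀ s p.1 then (M p.1 (s p.1)).op (F p.1)
          else ContinuousLinearMap.id ℂ (H p.1)).IsPositive := by
      intro p
      split_ifs
      · exact (M _ _).isPositive _ (hF _)
      · exact ContinuousLinearMap.isPositive_one
    -- Both `tr[C A] + tr[T A]` and `tr[C A] - tr[T A]` are real, hence so is `tr[T A]`; its real
    -- part is the difference of the two measures.
    have h1 := (Complex.le_def.1 (hTC.add.trace_nonneg hC hT.isTraceClass _ hpos)).2
    have h2 := (Complex.le_def.1 (TensorPositive.trace_nonneg hC hT.isTraceClass.neg (by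
      rw [← sub_eq_add_neg]
      exact hTC.sub) _ hpos)).2
    change _ = (_ + trace (T ∘L copyEffect n₀ M s F)).im at h1
    change _ = (trace (C ∘L copyEffect n₀ M s F) + _).im at h2
    change _ = (trace (C ∘L copyEffect n₀ M s F) + _).im at h1
    change _ = (_ + trace ((-T) ∘L copyEffect n₀ M s F)).im at h2
    rw [ContinuousLinearMap.neg_comp, trace_neg] at h2
    simp only [Complex.add_im, Complex.neg_im, Complex.zero_im] at h1 h2
    rw [Measure.toSignedMeasure_sub_apply hm, hα s F hF, hβ s F hF, ← hj]
    apply Complex.ext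
    · simp only [Complex.ofReal_re, Complex.add_re, Complex.neg_re]
      ring
    · simp only [Complex.ofReal_im]
      linarith
  have huniv : ∀ s : ∀ n, Fin (S n), {ω : OutcomeSpace S Λ | ∀ n, ω ⟨n, s n⟩ ∈ Set.univ} =
      Set.univ := fun s => by simp
  have hsim : Simulates ρ M (α.toSignedMeasure - β.toSignedMeasure) := by
    refine ⟨?_, hmarg⟩
    have := hmarg s₀ (fun _ => Set.univ) fun _ => .univ
    rw [huniv, jointProb] at this
    simp only [POVM.op_univ] at this
    rw [tensorOp_id, ContinuousLinearMap.comp_id, hρ.trace_eq_one] at this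
    exact_mod_cast this
  refine (iInf₂_le _ hsim).trans ((totalVariation_sub_le α β).trans (le_of_eq ?_))
  -- The total masses are the real parts of `(tr C ± tr T) / 2`, with sum that of `tr C`.
  have h1 := hα s₀ (fun _ => Set.univ) fun _ => .univ
  have h2 := hβ s₀ (fun _ => Set.univ) fun _ => .univ
  rw [huniv, copyEffect_univ, ContinuousLinearMap.comp_id] at h1 h2
  rw [h1, h2]
  congr 1
  simp only [ContinuousLinearMap.comp_id, Complex.add_re, Complex.neg_re]
  ring

end UpperBound

end QuantumBell

theorem theorem3 {N : ℕ} (hN : 2 ≤ N) (H : Fin N → Type u)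
    [∀ n, NormedAddCommGroup (H n)] [∀ n, InnerProductSpace ℂ (H n)]
    [∀ n, CompleteSpace (H n)] [∀ n, TopologicalSpace.SeparableSpace (H n)]
    (ρ : QuantumBell.HTensor H →L[ℂ] QuantumBell.HTensor H) (hρ : QuantumBell.IsState ρ)
    (S : Fin N → ℕ) (hS : ∀ n, 1 ≤ S n) :
    1 ≤ QuantumBell.bellViolation.{u, v} ρ S ∧
    QuantumBell.bellViolation.{u, v} ρ S ≤
      (⨅ (n : Fin N)
        (T : QuantumBell.CopyTensor H (Function.update S n 1) →L[ℂ]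
          QuantumBell.CopyTensor H (Function.update S n 1))
        (_ : QuantumBell.IsSourceOperator ρ (Function.update S n 1) T),
        QuantumBell.coveringNorm T) ∧
    (⨅ (n : Fin N)
        (T : QuantumBell.CopyTensor H (Function.update S n 1) →L[ℂ]
          QuantumBell.CopyTensor H (Function.update S n 1))
        (_ : QuantumBell.IsSourceOperator ρ (Function.update S n 1) T),
        QuantumBell.coveringNorm T) ≤
      ⨅ (n : Fin N)
        (T : QuantumBell.CopyTensor H (Function.update S n 1) →L[ℂ]
          QuantumBell.CopyTensor H (Function.update S n 1))
        (_ : QuantumBell.IsSourceOperator ρ (Function.update S n 1) T),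
        QuantumBell.traceNorm T := by
  refine ⟨QuantumBell.one_le_bellViolation ρ S, ?_, ?_⟩
  · refine le_iInf fun n => le_iInf₂ fun T hT => le_iInf fun C => le_iInf₂ fun hC hTC => ?_
    refine iSup_le fun Λ => iSup₂_le fun _ _ => iSup_le fun M => ?_
    exact QuantumBell.scenarioParam_le_of_isCovering n hρ hS M hT hC hTC
  · exact iInf_mono fun n => iInf₂_mono fun T hT =>
      QuantumBell.coveringNorm_le_traceNorm hT.isSelfAdjoint
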